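/- Let $f:\mathbb{R}^d\to\mathbb{R}^d$ and $B:\mathbb{R}^d\to\mathbb{R}^{d\times m}$ be continuously differentiable, let $Q\in\mathbb{R}^{d\times d}$ be symmetric positive semidefinite and $R\in\mathbb{R}^{m\times m}$ symmetric positive definite. For $x\in\mathbb{R}^d$ let $$V(x)=\inf_u\int_0^\infty \bigl(y(s)^\top Q\,y(s)+u(s)^\top R\,u(s)\bigr)\,ds\in[0,\infty],$$ where the infimum is over all $u\in L^\infty([0,\infty);\mathbb{R}^m)$ for which $\dot y=f(y)+B(y)u$, $y(0)=x$, has a solution $y$ on $[0,\infty)$. Let $\mathcal O\subseteq\mathbb{R}^d$ be an open neighbourhood of the origin and $A:\mathbb{R}^d\to\mathbb{R}^{d\times d}$ be continuous on $\mathcal O$, with $f(x)=A(x)x$ for $x\in\mathcal O$, and suppose that for every $x\in\mathcal O$ the pair $(A(x),B(x))$ is stabilizable and the pair $(A(x),Q^{1/2})$ is detectable. For $x\in\mathcal O$ let $P(x)$ be symmetric positive semidefinite with $$A(x)^\top P(x)+P(x)A(x)-P(x)B(x)R^{-1}B(x)^\top P(x)+Q=0,$$ and suppose that $P$ is continuously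 differentiable on $\mathcal O$. Put $V_S(x)=x^\top P(x)x$ and let $$E(x)=\nabla V_S(x)^\top f(x)-\tfrac14\nabla V_S(x)^\top B(x)R^{-1}B(x)^\top\nabla V_S(x)+x^\top Qx$$ be the residual of $V_S$ in the Hamilton–Jacobi–Bellman equation. Suppose that $V$ is differentiable in a neighbourhood of the origin, and let $$u^*(x)=-\tfrac12R^{-1}B(x)^\top\nabla V(x),\qquad \tilde u_S(x)=-\tfrac12R^{-1}B(x)^\top\nabla V_S(x).$$ (1) For every $x$ in some neighbourhood of the origin, $V(x)<\infty$, and for all solutions $y^*$ and $\tilde y_S$ on $[0,\infty)$ of the closed-loop systems $\dot y=f(y)+B(y)u^*(y)$ and $\dot y=f(y)+B(y)\tilde u_S(y)$, respectively, that start at $x$, the functions $E(y^*(\cdot))$ and $E(\tilde y_S(\cdot))$ are integrable on $(0,\infty)$ and $$|V_S(x)-V(x)|\le\max\Bigl\{\int_0^\infty|E(y^*(t))|\,dt,\ \int_0^\infty|E(\tilde y_S(t))|\,dt\Bigr\}.$$ (2) Say that $\dot y=F(y)$ is exponentially stable with rate $\lambda$ if there is a constant $K$ such that, for all $x$ near the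 origin, solutions on $[0,\infty)$ with $y(0)=x$ exist and all of them satisfy $\|y(t)\|\le Ke^{-\lambda t}\|x\|$ for $t\ge0$. If both closed-loop systems in (1) are exponentially stable, and $\lambda>0$ is a common rate, then for every neighbourhood $\Omega\subseteq\mathcal O$ of the origin there is a constant $C>0$ such that, for all $x$ in some neighbourhood of the origin, $$|V_S(x)-V(x)|\le\frac{C}{\lambda}\,\|E\|_\infty,\qquad \|E\|_\infty=\sup_{z\in\Omega}|E(z)|\in[0,\infty].$$ -/

import Mathlib

open MeasureTheory Set Filter Topology
open scoped ENNReal Matrix MatrixOrder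

noncomputable section

namespace SDRE

/-- A real square matrix is stable if all its (complex) eigenvalues lie in the open left half
plane. -/
def IsStable {d : ℕ} (M : Matrix (Fin d) (Fin d) ℝ) : Prop :=
  ∀ μ ∈ spectrum ℂ (M.map (algebraMap ℝ ℂ)), μ.re < 0

/-- The pair `(A, B)` is stabilizable if `A - B K` is stable for some feedback matrix `K`. -/
def Stabilizable {d m : ℕ} (A : Matrix (Fin d) (Fin d) ℝ) (B : Matrix (Fin d) (Fin m) ℝ) : Prop :=
  ∃ K : Matrix (Fin m) (Fin d) ℝ, IsStable (A - B * K)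

/-- The pair `(A, C)` is detectable if `(Aᵀ, Cᵀ)` is stabilizable. -/
def Detectable {d p : ℕ} (A : Matrix (Fin d) (Fin d) ℝ) (C : Matrix (Fin p) (Fin d) ℝ) : Prop :=
  Stabilizable Aᵀ Cᵀ

/-- The gradient of a scalar function on `ℝ^d`, as the vector of its partial derivatives. -/
def grad {d : ℕ} (W : (Fin d → ℝ) → ℝ) (x : Fin d → ℝ) : Fin d → ℝ :=
  fun i => fderiv ℝ W x (Pi.single i 1)

/-- `y` is the state trajectory on `[0, ∞)` issuing from `x` under the admissible (measurable and
essentially bounded) open-loop control `u`: a Carathéodory solution of `y' = f(y) + B(y) u`,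
`y(0) = x`. -/
structure IsControlled {d m : ℕ} (f : (Fin d → ℝ) → Fin d → ℝ)
    (B : (Fin d → ℝ) → Matrix (Fin d) (Fin m) ℝ) (x : Fin d → ℝ)
    (u : ℝ → Fin m → ℝ) (y : ℝ → Fin d → ℝ) : Prop where
  control_memLp : MemLp u ∞ (volume.restrict (Ici 0))
  continuousOn : ContinuousOn y (Ici 0)
  eq_integral : ∀ t, 0 ≤ t → y t = x + ∫ s in (0 : ℝ)..t, (f (y s) + B (y s) *ᵥ u s)

/-- The running cost `xᵀ Q x + uᵀ R u`. -/
def runningCost {d m : ℕ} (Q : Matrix (Fin d) (Fin d) ℝ) (R : Matrix (Fin m) (Fin m) ℝ)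
    (x : Fin d → ℝ) (u : Fin m → ℝ) : ℝ :=
  x ⬝ᵥ Q *ᵥ x + u ⬝ᵥ R *ᵥ u

/-- The infinite-horizon cost, with values in `[0, ∞]` (the running cost is nonnegative when `Q`
and `R` are positive semidefinite). -/
def cost {d m : ℕ} (Q : Matrix (Fin d) (Fin d) ℝ) (R : Matrix (Fin m) (Fin m) ℝ)
    (u : ℝ → Fin m → ℝ) (y : ℝ → Fin d → ℝ) : ℝ≥0∞ :=
  ∫⁻ s in Ici (0 : ℝ), ENNReal.ofReal (runningCost Q R (y s) (u s))

/-- The value function of the unconstrained problem, with values in `[0, ∞]`: the infimum of the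
cost over all admissible controls whose trajectory from `x` exists on `[0, ∞)`. -/
def valueENN {d m : ℕ} (f : (Fin d → ℝ) → Fin d → ℝ)
    (B : (Fin d → ℝ) → Matrix (Fin d) (Fin m) ℝ) (Q : Matrix (Fin d) (Fin d) ℝ)
    (R : Matrix (Fin m) (Fin m) ℝ) (x : Fin d → ℝ) : ℝ≥0∞ :=
  ⨅ (u : ℝ → Fin m → ℝ) (y : ℝ → Fin d → ℝ) (_ : IsControlled f B x u y), cost Q R u y

/-- The value function as a real number; meaningful where `valueENN` is finite. -/
def value {d m : ℕ} (f : (Fin d → ℝ) → Fin d → ℝ)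
    (B : (Fin d → ℝ) → Matrix (Fin d) (Fin m) ℝ) (Q : Matrix (Fin d) (Fin d) ℝ)
    (R : Matrix (Fin m) (Fin m) ℝ) (x : Fin d → ℝ) : ℝ :=
  (valueENN f B Q R x).toReal

/-- `P` solves the algebraic Riccati equation `Aᵀ P + P A - P B R⁻¹ Bᵀ P + Q = 0`. -/
def SolvesRiccati {d m : ℕ} (A : Matrix (Fin d) (Fin d) ℝ) (B : Matrix (Fin d) (Fin m) ℝ)
    (Q : Matrix (Fin d) (Fin d) ℝ) (R : Matrix (Fin m) (Fin m) ℝ)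
    (P : Matrix (Fin d) (Fin d) ℝ) : Prop :=
  Aᵀ * P + P * A - P * B * R⁻¹ * Bᵀ * P + Q = 0

/-- The approximate value function `V_S(x) = xᵀ P(x) x`. -/
def valueS {d : ℕ} (P : (Fin d → ℝ) → Matrix (Fin d) (Fin d) ℝ) (x : Fin d → ℝ) : ℝ :=
  x ⬝ᵥ P x *ᵥ x

/-- The feedback `-½ R⁻¹ B(x)ᵀ ∇W(x)` generated by a function `W`. For the value function `W = V`
this is the optimal control `u*`; for `W = V_S` it is the control `ũ_S`. -/
def feedback {d m : ℕ} (B : (Fin d → ℝ) → Matrix (Fin d) (Fin m) ℝ)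
    (R : Matrix (Fin m) (Fin m) ℝ) (W : (Fin d → ℝ) → ℝ) (x : Fin d → ℝ) : Fin m → ℝ :=
  -((1 / 2 : ℝ) • (R⁻¹ *ᵥ ((B x)ᵀ *ᵥ grad W x)))

/-- The closed-loop vector field `f(x) + B(x) k(x)` under the feedback `k` generated by `W`. -/
def closedLoop {d m : ℕ} (f : (Fin d → ℝ) → Fin d → ℝ)
    (B : (Fin d → ℝ) → Matrix (Fin d) (Fin m) ℝ) (R : Matrix (Fin m) (Fin m) ℝ)
    (W : (Fin d → ℝ) → ℝ) (x : Fin d → ℝ) : Fin d → ℝ :=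
  f x + B x *ᵥ feedback B R W x

/-- The residual of `W` in the Hamilton-Jacobi-Bellman equation of the unconstrained problem,
`∇W(x)ᵀ f(x) - ¼ ∇W(x)ᵀ B(x) R⁻¹ B(x)ᵀ ∇W(x) + xᵀ Q x`. -/
def hjbResidual {d m : ℕ} (f : (Fin d → ℝ) → Fin d → ℝ)
    (B : (Fin d → ℝ) → Matrix (Fin d) (Fin m) ℝ) (Q : Matrix (Fin d) (Fin d) ℝ)
    (R : Matrix (Fin m) (Fin m) ℝ) (W : (Fin d → ℝ) → ℝ) (x : Fin d → ℝ) : ℝ :=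
  grad W x ⬝ᵥ f x - (1 / 4 : ℝ) * (grad W x ⬝ᵥ (B x * R⁻¹ * (B x)ᵀ) *ᵥ grad W x)
    + x ⬝ᵥ Q *ᵥ x

/-- `y` is a (classical) solution on `[0, ∞)` of `y' = F(y)`, `y(0) = x`. -/
def IsSolution {d : ℕ} (F : (Fin d → ℝ) → Fin d → ℝ) (x : Fin d → ℝ)
    (y : ℝ → Fin d → ℝ) : Prop :=
  y 0 = x ∧ ∀ t, 0 ≤ t → HasDerivWithinAt y (F (y t)) (Ici 0) t

/-- The system `y' = F(y)` is (locally) exponentially stable at the origin with decay rate `lam`: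
for some constant `K` and all `x` near the origin, solutions from `x` exist on `[0, ∞)`, and all
of them satisfy `‖y(t)‖ ≤ K exp(-lam t) ‖x‖`. -/
def ExpStable {d : ℕ} (F : (Fin d → ℝ) → Fin d → ℝ) (lam : ℝ) : Prop :=
  ∃ K : ℝ, ∀ᶠ x in 𝓝 (0 : Fin d → ℝ),
    (∃ y, IsSolution F x y) ∧
    ∀ y, IsSolution F x y → ∀ t, 0 ≤ t → ‖y t‖ ≤ K * Real.exp (-lam * t) * ‖x‖

/-- The supremum norm of `E` over `Ω`, with values in `[0, ∞]`. -/
def supNormOn {d : ℕ} (E : (Fin d → ℝ) → ℝ) (Ω : Set (Fin d → ℝ)) : ℝ≥0∞ :=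
  ⨆ x ∈ Ω, ENNReal.ofReal |E x|

end SDRE

end

/-! For a function W with residual E_W, completing the square in u gives, for every control value u,
∇W·(f + Bu) = -ℓ(x,u) + E_W + |u - u_W|²_R, where ℓ is the running cost and u_W the feedback
generated by W (`completing_square`, `fderiv_controlled`). Everything follows by integrating this
along trajectories.

Upper bound on V: along ỹ_S the function V_S changes at rate -ℓ + E, so the cost of ũ_S is at most
V_S(x) + ∫|E|. Lower bound: along y* the difference V - V_S changes at rate E_V - E - |u* - ũ_S|²_R.
This is at most |E|, because E_V ≤ 0 wherever V is finite at the point and differentiable there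
(`hjbResidual_value_nonpos`). Half of the dynamic programming principle suffices for that; the full
Hamilton–Jacobi–Bellman equation is never needed.

Integration over all time requires trajectories that remain near 0 and are square integrable,
although part (1) assumes no stability. Detectability at 0 supplies a quadratic form whose rate of
change is at most -c|x|² + κℓ. Adding κ times a storage function (V or V_S) cancels the running
cost, and the defect left over is small because E = o(|x|²): the Riccati equation removes all
quadratic terms of E (`hjbResidual_valueS_le`, `exists_trapping`). The same trapping, applied to the
linear feedback of P(0), shows that V is finite and O(|x|²) (`exists_valueENN_le`).

Part (2) inserts the exponential decay into the bound of part (1), using that |E(z)| is at most a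
constant times ‖E‖_∞ |z|² near 0. -/

namespace SDRE

/-! ### Matrix estimates, completion of the square, Lyapunov's theorem -/

section LinearAlgebra

variable {m n p : ℕ}

/-- The sum of the absolute values of the entries, a bound for the operator norm. -/
def entrySum (M : Matrix (Fin m) (Fin n) ℝ) : ℝ := ∑ i, ∑ j, |M i j|

lemma entrySum_nonneg (M : Matrix (Fin m) (Fin n) ℝ) : 0 ≤ entrySum M :=
  Finset.sum_nonneg fun _ _ => Finset.sum_nonneg fun _ _ => abs_nonneg _

@[fun_prop]
lemma continuous_entrySum : Continuous (entrySum : Matrix (Fin m) (Fin n) ℝ → ℝ) := by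
  unfold entrySum
  fun_prop

@[simp]
lemma entrySum_zero : entrySum (0 : Matrix (Fin m) (Fin n) ℝ) = 0 := by simp [entrySum]

lemma norm_mulVec_le (M : Matrix (Fin m) (Fin n) ℝ) (v : Fin n → ℝ) :
    ‖M *ᵥ v‖ ≤ entrySum M * ‖v‖ := by
  refine (pi_norm_le_iff_of_nonneg (mul_nonneg (entrySum_nonneg M) (norm_nonneg v))).2 fun i => ?_
  calc ‖(M *ᵥ v) i‖ ≤ ∑ j, ‖M i j * v j‖ := norm_sum_le Finset.univ fun j => M i j * v j
    _ ≤ ∑ j, |M i j| * ‖v‖ := by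
        gcongr with j
        rw [norm_mul, Real.norm_eq_abs]
        gcongr
        exact norm_le_pi_norm v j
    _ = (∑ j, |M i j|) * ‖v‖ := by rw [Finset.sum_mul]
    _ ≤ entrySum M * ‖v‖ := by
        gcongr
        exact Finset.single_le_sum (f := fun i => ∑ j, |M i j|)
          (fun _ _ => Finset.sum_nonneg fun _ _ => abs_nonneg _) (Finset.mem_univ i)

lemma abs_dotProduct_le (x y : Fin n → ℝ) : |x ⬝ᵥ y| ≤ n * ‖x‖ * ‖y‖ := by
  calc |x ⬝ᵥ y| ≤ ∑ i, |x i * y i| := Finset.abs_sum_le_sum_abs _ _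
    _ ≤ ∑ _i : Fin n, ‖x‖ * ‖y‖ := by
        gcongr with i
        rw [abs_mul]
        exact mul_le_mul (norm_le_pi_norm x i) (norm_le_pi_norm y i) (abs_nonneg _) (norm_nonneg _)
    _ = n * ‖x‖ * ‖y‖ := by simp [mul_assoc]

lemma norm_sq_le_dotProduct (x : Fin n → ℝ) : ‖x‖ ^ 2 ≤ x ⬝ᵥ x := by
  have h0 : 0 ≤ x ⬝ᵥ x := Finset.sum_nonneg fun i _ => mul_self_nonneg (x i)
  have : ‖x‖ ≤ √(x ⬝ᵥ x) := by
    refine (pi_norm_le_iff_of_nonneg (Real.sqrt_nonneg _)).2 fun i => Real.abs_le_sqrt ?_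
    rw [sq]
    exact Finset.single_le_sum (f := fun i => x i * x i) (fun i _ => mul_self_nonneg (x i))
      (Finset.mem_univ i)
  calc ‖x‖ ^ 2 ≤ √(x ⬝ᵥ x) ^ 2 := by gcongr
    _ = _ := Real.sq_sqrt h0

lemma abs_dotProduct_mulVec_le (M : Matrix (Fin m) (Fin n) ℝ) (x : Fin m → ℝ) (y : Fin n → ℝ) :
    |x ⬝ᵥ M *ᵥ y| ≤ m * entrySum M * ‖x‖ * ‖y‖ := by
  refine (abs_dotProduct_le _ _).trans ?_
  calc m * ‖x‖ * ‖M *ᵥ y‖ ≤ m * ‖x‖ * (entrySum M * ‖y‖) := by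
        gcongr; exact norm_mulVec_le _ _
    _ = _ := by ring

lemma dotProduct_mulVec_comm {M : Matrix (Fin n) (Fin n) ℝ} (hM : Mᵀ = M) (x y : Fin n → ℝ) :
    x ⬝ᵥ M *ᵥ y = y ⬝ᵥ M *ᵥ x := by
  rw [Matrix.dotProduct_mulVec, ← Matrix.mulVec_transpose, hM, dotProduct_comm]

lemma transpose_eq_of_isHermitian {M : Matrix (Fin n) (Fin n) ℝ} (hM : M.IsHermitian) : Mᵀ = M := by
  rw [← Matrix.conjTranspose_eq_transpose_of_trivial]; exact hM

lemma posSemidef_nonneg {M : Matrix (Fin n) (Fin n) ℝ} (hM : M.PosSemidef) (x : Fin n → ℝ) :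
    0 ≤ x ⬝ᵥ M *ᵥ x := by simpa using hM.dotProduct_mulVec_nonneg x

lemma exists_pos_le_of_posDef {R : Matrix (Fin m) (Fin m) ℝ} (hR : R.PosDef) :
    ∃ r > 0, ∀ u : Fin m → ℝ, r * ‖u‖ ^ 2 ≤ u ⬝ᵥ R *ᵥ u := by
  have hpos : ∀ u : Fin m → ℝ, u ≠ 0 → 0 < u ⬝ᵥ R *ᵥ u := fun u hu => by
    simpa using hR.dotProduct_mulVec_pos hu
  have hcont : Continuous fun u : Fin m → ℝ => u ⬝ᵥ R *ᵥ u := by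
    unfold dotProduct Matrix.mulVec dotProduct
    fun_prop
  -- The unit sphere is empty exactly when m = 0.
  rcases (Metric.sphere (0 : Fin m → ℝ) 1).eq_empty_or_nonempty with he | hne
  · refine ⟨1, one_pos, fun u => ?_⟩
    by_cases hu : u = 0
    · simp [hu]
    · have : ‖u‖⁻¹ • u ∈ Metric.sphere (0 : Fin m → ℝ) 1 := by
        simp [norm_smul, hu]
      simp [he] at this
  · obtain ⟨v, hv, hmin⟩ := (isCompact_sphere (0 : Fin m → ℝ) 1).exists_isMinOn hne
      hcont.continuousOn
    have hv0 : v ≠ 0 := by rintro rfl; simp at hv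
    refine ⟨_, hpos v hv0, fun u => ?_⟩
    by_cases hu : u = 0
    · simp [hu]
    · have h1 : ‖u‖⁻¹ • u ∈ Metric.sphere (0 : Fin m → ℝ) 1 := by
        simp [norm_smul, hu]
      have h2 : v ⬝ᵥ R *ᵥ v ≤ (‖u‖⁻¹ • u) ⬝ᵥ R *ᵥ (‖u‖⁻¹ • u) := hmin h1
      have hu' : 0 < ‖u‖ := norm_pos_iff.2 hu
      rw [Matrix.mulVec_smul, smul_dotProduct, dotProduct_smul, smul_eq_mul, smul_eq_mul] at h2
      calc _ ≤ (‖u‖⁻¹ * (‖u‖⁻¹ * u ⬝ᵥ R *ᵥ u)) * ‖u‖ ^ 2 := by gcongr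
        _ = _ := by field_simp

/-- The Hamiltonian-minimizing control for the costate `q` at a state with input matrix `B`. -/
noncomputable def minControl (B : Matrix (Fin n) (Fin m) ℝ) (R : Matrix (Fin m) (Fin m) ℝ)
    (q : Fin n → ℝ) : Fin m → ℝ := -((1 / 2 : ℝ) • (R⁻¹ *ᵥ (Bᵀ *ᵥ q)))

/-- The Hamiltonian is quadratic in u with leading part R. Hence it equals its minimum, the bracket
on the right, plus the R-square of the distance from the minimizer. -/
lemma completing_square (B : Matrix (Fin n) (Fin m) ℝ) {Q : Matrix (Fin n) (Fin n) ℝ}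
    {R : Matrix (Fin m) (Fin m) ℝ} (hR : R.PosDef) (q g x : Fin n → ℝ) (u : Fin m → ℝ) :
    q ⬝ᵥ (g + B *ᵥ u) + runningCost Q R x u =
      (q ⬝ᵥ g - (1 / 4 : ℝ) * (q ⬝ᵥ (B * R⁻¹ * Bᵀ) *ᵥ q) + x ⬝ᵥ Q *ᵥ x) +
        (u - minControl B R q) ⬝ᵥ R *ᵥ (u - minControl B R q) := by
  have hinv : IsUnit R.det := (Matrix.isUnit_iff_isUnit_det R).1 hR.isUnit
  have hsym := transpose_eq_of_isHermitian hR.isHermitian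
  set w : Fin m → ℝ := Bᵀ *ᵥ q with hw
  have h1 : ∀ v : Fin m → ℝ, q ⬝ᵥ B *ᵥ v = w ⬝ᵥ v := fun v => by
    rw [hw, Matrix.dotProduct_mulVec, Matrix.mulVec_transpose]
  have h2 : q ⬝ᵥ (B * R⁻¹ * Bᵀ) *ᵥ q = w ⬝ᵥ R⁻¹ *ᵥ w := by
    rw [← Matrix.mulVec_mulVec, ← Matrix.mulVec_mulVec, h1]
  have h3 : R *ᵥ (R⁻¹ *ᵥ w) = w := by
    rw [Matrix.mulVec_mulVec, Matrix.mul_nonsing_inv _ hinv, Matrix.one_mulVec]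
  have h4 : (R⁻¹ *ᵥ w) ⬝ᵥ R *ᵥ u = w ⬝ᵥ u := by
    rw [dotProduct_mulVec_comm hsym, h3, dotProduct_comm]
  have h5 : minControl B R q = -((1 / 2 : ℝ) • (R⁻¹ *ᵥ w)) := rfl
  rw [h5, h2, dotProduct_add, h1, runningCost]
  simp only [sub_neg_eq_add, Matrix.mulVec_add, Matrix.mulVec_smul, h3, dotProduct_add,
    add_dotProduct, smul_dotProduct, dotProduct_smul, h4, smul_eq_mul]
  rw [dotProduct_comm u w, dotProduct_comm (R⁻¹ *ᵥ w) w]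
  ring

lemma spectrum_transpose_map (M : Matrix (Fin n) (Fin n) ℝ) :
    spectrum ℂ (Mᵀ.map (algebraMap ℝ ℂ)) = spectrum ℂ (M.map (algebraMap ℝ ℂ)) := by
  ext μ
  have : algebraMap ℂ (Matrix (Fin n) (Fin n) ℂ) μ - Mᵀ.map (algebraMap ℝ ℂ) =
      (algebraMap ℂ (Matrix (Fin n) (Fin n) ℂ) μ - M.map (algebraMap ℝ ℂ))ᵀ := by
    rw [Matrix.transpose_sub, Matrix.transpose_map, Matrix.algebraMap_eq_diagonal,
      Matrix.diagonal_transpose]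
  rw [spectrum.mem_iff, spectrum.mem_iff, this, Matrix.isUnit_transpose]

lemma IsStable.transpose {M : Matrix (Fin n) (Fin n) ℝ} (hM : IsStable M) : IsStable Mᵀ := by
  intro μ hμ
  exact hM μ (by rwa [spectrum_transpose_map] at hμ)

lemma mem_spectrum_iff_exists (M : Matrix (Fin n) (Fin n) ℂ) (μ : ℂ) :
    μ ∈ spectrum ℂ M ↔ ∃ v ≠ 0, M *ᵥ v = μ • v := by
  have h : algebraMap ℂ (Matrix (Fin n) (Fin n) ℂ) μ = μ • 1 := Algebra.algebraMap_eq_smul_one μ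
  rw [spectrum.mem_iff, Matrix.isUnit_iff_isUnit_det, isUnit_iff_ne_zero, not_not,
    ← Matrix.exists_mulVec_eq_zero_iff]
  simp only [h, Matrix.sub_mulVec, Matrix.smul_mulVec, Matrix.one_mulVec, sub_eq_zero, eq_comm]

section SpectralRadius

attribute [local instance] Matrix.linftyOpNormedRing Matrix.linftyOpNormedAlgebra

/-- Gelfand's formula: the k-th roots of the norms of the powers tend to the spectral radius, which
is below 1. -/
lemma exists_pow_norm_lt [Nonempty (Fin n)] (N : Matrix (Fin n) (Fin n) ℂ)
    (hN : ∀ μ ∈ spectrum ℂ N, ‖μ‖ < 1) {ε : ℝ} (hε : 0 < ε) : ∃ k : ℕ, 0 < k ∧ ‖N ^ k‖ < ε := by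
  have h1 : spectralRadius ℂ N < 1 := by
    have := spectrum.spectralRadius_lt_of_forall_lt N (r := 1) fun k hk => by
      have := hN k hk
      exact_mod_cast this
    simpa using this
  obtain ⟨r, hr1, hr2⟩ := ENNReal.lt_iff_exists_nnreal_btwn.1 h1
  have h2 := (spectrum.pow_nnnorm_pow_one_div_tendsto_nhds_spectralRadius N).eventually_lt_const hr1
  have hr : (r : ℝ) < 1 := by exact_mod_cast hr2
  have h3 := (tendsto_pow_atTop_nhds_zero_of_lt_one r.2 hr).eventually_lt_const hε
  obtain ⟨k, ⟨hk1, hk2⟩, hk⟩ := ((h2.and h3).and (eventually_gt_atTop 0)).exists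
  refine ⟨k, hk, lt_of_le_of_lt ?_ hk2⟩
  have hk' : (k : ℝ) ≠ 0 := by positivity
  have h4 : (‖N ^ k‖₊ : ℝ≥0∞) ≤ (r : ℝ≥0∞) ^ k := by
    calc (‖N ^ k‖₊ : ℝ≥0∞) = ((‖N ^ k‖₊ : ℝ≥0∞) ^ (1 / k : ℝ)) ^ (k : ℝ) := by
          rw [← ENNReal.rpow_mul, one_div_mul_cancel hk', ENNReal.rpow_one]
      _ ≤ (r : ℝ≥0∞) ^ (k : ℝ) := by gcongr
      _ = (r : ℝ≥0∞) ^ k := ENNReal.rpow_natCast _ _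
  exact_mod_cast h4

lemma exists_pow_mulVec_le [Nonempty (Fin n)] (N : Matrix (Fin n) (Fin n) ℝ)
    (hN : ∀ μ ∈ spectrum ℂ (N.map (algebraMap ℝ ℂ)), ‖μ‖ < 1) {ε : ℝ} (hε : 0 < ε) :
    ∃ k : ℕ, 0 < k ∧ ∀ v : Fin n → ℝ, ‖N ^ k *ᵥ v‖ ≤ ε * ‖v‖ := by
  obtain ⟨k, hk, hlt⟩ := exists_pow_norm_lt _ hN hε
  refine ⟨k, hk, fun v => ?_⟩
  have hnorm : ∀ w : Fin n → ℝ, ‖(algebraMap ℝ ℂ) ∘ w‖ = ‖w‖ := fun w => by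
    simp [Pi.norm_def, Function.comp_def]
  have hmap : (algebraMap ℝ ℂ) ∘ (N ^ k *ᵥ v) =
      (N.map (algebraMap ℝ ℂ)) ^ k *ᵥ ((algebraMap ℝ ℂ) ∘ v) := by
    rw [← Matrix.map_pow]
    ext i
    exact RingHom.map_mulVec (algebraMap ℝ ℂ) (N ^ k) v i
  rw [← hnorm, hmap, ← hnorm v]
  exact (Matrix.linfty_opNorm_mulVec _ _).trans (by gcongr)

end SpectralRadius

/-- Here μ = (1 + ν)/(1 - ν), and a point of the left half plane is closer to -1 than to 1. -/
lemma norm_lt_one_of_cayley {μ ν : ℂ} (h : ν * (1 + μ) = μ - 1) (hν : ν.re < 0) : ‖μ‖ < 1 := by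
  have h1 : ‖ν + 1‖ < ‖ν - 1‖ := by
    rw [← sq_lt_sq₀ (norm_nonneg _) (norm_nonneg _), Complex.sq_norm, Complex.sq_norm,
      Complex.normSq_apply, Complex.normSq_apply]
    simp
    nlinarith
  have h2 : (1 - ν) * μ = ν + 1 := by linear_combination -h
  have h3 : ‖ν - 1‖ * ‖μ‖ = ‖ν + 1‖ := by rw [← h2, norm_mul, norm_sub_rev]
  have h4 : 0 < ‖ν - 1‖ := (norm_nonneg _).trans_lt h1
  by_contra hc
  push Not at hc
  nlinarith

/-- Lyapunov's theorem: a stable matrix admits a quadratic Lyapunov function. -/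
lemma IsStable.exists_lyapunov {M : Matrix (Fin n) (Fin n) ℝ} (hM : IsStable M) :
    ∃ X : Matrix (Fin n) (Fin n) ℝ, Xᵀ = X ∧ (∀ x : Fin n → ℝ, x ⬝ᵥ x ≤ x ⬝ᵥ X *ᵥ x) ∧
      ∃ c > 0, ∀ x : Fin n → ℝ, 2 * (x ⬝ᵥ X *ᵥ (M *ᵥ x)) ≤ -c * ‖x‖ ^ 2 := by
  rcases isEmpty_or_nonempty (Fin n) with he | hne
  · exact ⟨0, by simp, fun x => by simp [Subsingleton.elim x 0], 1, one_pos,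
      fun x => by simp [Subsingleton.elim x 0]⟩
  set MC := M.map (algebraMap ℝ ℂ) with hMC
  have hdet : IsUnit (1 - M).det := by
    rw [isUnit_iff_ne_zero]
    intro h0
    obtain ⟨v, hv, hv0⟩ := Matrix.exists_mulVec_eq_zero_iff.2 h0
    rw [Matrix.sub_mulVec, Matrix.one_mulVec, sub_eq_zero] at hv0
    have : (1 : ℂ) ∈ spectrum ℂ MC := by
      rw [mem_spectrum_iff_exists]
      refine ⟨(algebraMap ℝ ℂ) ∘ v, fun h => hv ?_, ?_⟩
      · ext i
        have := congrFun h i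
        simpa using this
      · rw [one_smul]
        ext i
        rw [hMC, ← RingHom.map_mulVec, ← hv0]
        rfl
    have := hM 1 this
    norm_num at this
  -- The Cayley transform turns the Lyapunov inequality for M into a Stein inequality for N, where
  -- powers replace the matrix exponential.
  set N := (1 + M) * (1 - M)⁻¹ with hN
  have hN1 : N * (1 - M) = 1 + M := by
    rw [hN, Matrix.mul_assoc, Matrix.nonsing_inv_mul _ hdet, Matrix.mul_one]
  have hspec : ∀ μ ∈ spectrum ℂ (N.map (algebraMap ℝ ℂ)), ‖μ‖ < 1 := by
    intro μ hμ
    obtain ⟨v, hv, hvμ⟩ := (mem_spectrum_iff_exists _ _).1 hμ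
    have e1 : (1 - MC) * ((1 - M)⁻¹).map (algebraMap ℝ ℂ) = 1 := by
      have := congrArg (fun X : Matrix (Fin n) (Fin n) ℝ => (algebraMap ℝ ℂ).mapMatrix X)
        (Matrix.mul_nonsing_inv _ hdet)
      simp only [map_mul, map_sub, map_one] at this
      exact this
    have e2 : N.map (algebraMap ℝ ℂ) * (1 - MC) = 1 + MC := by
      have := congrArg (fun X : Matrix (Fin n) (Fin n) ℝ => (algebraMap ℝ ℂ).mapMatrix X) hN1
      simp only [map_mul, map_sub, map_add, map_one] at this
      exact this
    set w := ((1 - M)⁻¹).map (algebraMap ℝ ℂ) *ᵥ v with hw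
    have e3 : (1 - MC) *ᵥ w = v := by rw [hw, Matrix.mulVec_mulVec, e1, Matrix.one_mulVec]
    have e4 : (1 + MC) *ᵥ w = μ • (1 - MC) *ᵥ w := by
      rw [e3, ← hvμ, ← e2, ← Matrix.mulVec_mulVec, e3]
    have hw0 : w ≠ 0 := by
      intro h
      rw [h, Matrix.mulVec_zero] at e3
      exact hv e3.symm
    rw [Matrix.add_mulVec, Matrix.sub_mulVec, Matrix.one_mulVec] at e4
    have e5 : (1 + μ) • MC *ᵥ w = (μ - 1) • w := by
      ext i
      have := congrFun e4 i
      simp only [Pi.add_apply, Pi.smul_apply, Pi.sub_apply, smul_eq_mul] at this ⊢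
      linear_combination this
    have hμ1 : 1 + μ ≠ 0 := by
      intro h
      rw [h, zero_smul] at e5
      have h' : μ - 1 ≠ 0 := by
        intro h2
        have : (2 : ℂ) = 0 := by linear_combination h - h2
        norm_num at this
      exact hw0 ((smul_eq_zero.1 e5.symm).resolve_left h')
    have e6 : MC *ᵥ w = ((μ - 1) / (1 + μ)) • w := by
      rw [div_eq_inv_mul, mul_smul, ← e5, smul_smul, inv_mul_cancel₀ hμ1, one_smul]
    exact norm_lt_one_of_cayley (div_mul_cancel₀ _ hμ1)
      (hM _ ((mem_spectrum_iff_exists _ _).2 ⟨w, hw0, e6⟩))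
  have hn : (0 : ℝ) < n := by
    have : 0 < n := Fin.pos_iff_nonempty.2 hne
    exact_mod_cast this
  -- The factor 1/(2n) pays for comparing the sup norm with the dot product, which costs a factor n.
  obtain ⟨k, hk, hNk⟩ := exists_pow_mulVec_le N hspec (ε := (2 * n)⁻¹) (by positivity)
  set q : ℕ → (Fin n → ℝ) → ℝ := fun j v => (N ^ j *ᵥ v) ⬝ᵥ (N ^ j *ᵥ v) with hq
  -- A truncated Stein series: the sum telescopes under N, and the last term `q k` is dominated by
  -- the first, so no limit is needed.
  set X : Matrix (Fin n) (Fin n) ℝ := ∑ j ∈ Finset.range k, (N ^ j)ᵀ * N ^ j with hX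
  have hXT : Xᵀ = X := by
    simp [hX, Matrix.transpose_sum, Matrix.transpose_mul]
  have hXq : ∀ v, v ⬝ᵥ X *ᵥ v = ∑ j ∈ Finset.range k, q j v := by
    intro v
    rw [hX, Matrix.sum_mulVec, dotProduct_sum]
    refine Finset.sum_congr rfl fun j _ => ?_
    rw [← Matrix.mulVec_mulVec, Matrix.dotProduct_mulVec, ← Matrix.mulVec_transpose,
      Matrix.transpose_transpose]
  have hq0 : ∀ j v, 0 ≤ q j v := fun j v => Finset.sum_nonneg fun i _ => mul_self_nonneg _
  have hstein : ∀ v, (N *ᵥ v) ⬝ᵥ X *ᵥ (N *ᵥ v) - v ⬝ᵥ X *ᵥ v = q k v - q 0 v := by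
    intro v
    rw [hXq, hXq, ← Finset.sum_range_sub (fun j => q j v), Finset.sum_sub_distrib]
    congr 1
    refine Finset.sum_congr rfl fun j _ => ?_
    simp only [hq, Matrix.mulVec_mulVec, ← pow_succ]
  refine ⟨X, hXT, fun x => ?_, (4 * (entrySum (1 - M)⁻¹ + 1) ^ 2)⁻¹, ?_, fun w => ?_⟩
  · rw [hXq]
    calc x ⬝ᵥ x = q 0 x := by simp [hq]
      _ ≤ _ := Finset.single_le_sum (f := fun j => q j x) (fun j _ => hq0 j x)
        (Finset.mem_range.2 hk)
  · have := entrySum_nonneg (1 - M)⁻¹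
    positivity
  · set v := (1 - M) *ᵥ w with hv
    have hwv : w = (1 - M)⁻¹ *ᵥ v := by
      rw [hv, Matrix.mulVec_mulVec, Matrix.nonsing_inv_mul _ hdet, Matrix.one_mulVec]
    have hNv : N *ᵥ v = w + M *ᵥ w := by
      rw [hv, Matrix.mulVec_mulVec, hN1, Matrix.add_mulVec, Matrix.one_mulVec]
    have hv' : v = w - M *ᵥ w := by rw [hv, Matrix.sub_mulVec, Matrix.one_mulVec]
    -- Polarization: N v = w + M w and v = w - M w, so the difference of the two quadratic values is
    -- four times the mixed term.
    have h4 : 4 * (w ⬝ᵥ X *ᵥ (M *ᵥ w)) = q k v - q 0 v := by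
      rw [← hstein v, hNv, hv']
      simp only [Matrix.mulVec_add, Matrix.mulVec_sub, dotProduct_add, add_dotProduct,
        dotProduct_sub, sub_dotProduct]
      rw [dotProduct_mulVec_comm hXT (M *ᵥ w) w]
      ring
    have h5 : q k v ≤ 1 / 2 * ‖v‖ ^ 2 := by
      have h6 := (le_abs_self _).trans (abs_dotProduct_le (N ^ k *ᵥ v) (N ^ k *ᵥ v))
      have h7 := hNk v
      have hn1 : (1 : ℝ) ≤ n := by exact_mod_cast Fin.pos_iff_nonempty.2 hne
      calc q k v ≤ n * ‖N ^ k *ᵥ v‖ * ‖N ^ k *ᵥ v‖ := h6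
        _ ≤ n * ((2 * (n : ℝ))⁻¹ * ‖v‖) * ((2 * (n : ℝ))⁻¹ * ‖v‖) := by gcongr
        _ = (1 / (4 * (n : ℝ))) * ‖v‖ ^ 2 := by field_simp; ring
        _ ≤ _ := by
          gcongr ?_ * _
          rw [div_le_div_iff₀ (by positivity) (by norm_num)]
          linarith
    have h8 : ‖v‖ ^ 2 ≤ q 0 v := by simpa [hq] using norm_sq_le_dotProduct v
    have h9 : ‖w‖ ≤ (entrySum (1 - M)⁻¹ + 1) * ‖v‖ := by
      rw [hwv]
      refine (norm_mulVec_le _ _).trans ?_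
      have := norm_nonneg v
      gcongr
      linarith
    have h10 : 0 < entrySum (1 - M)⁻¹ + 1 := by have := entrySum_nonneg (1 - M)⁻¹; linarith
    have h11 : (4 * (entrySum (1 - M)⁻¹ + 1) ^ 2)⁻¹ * ‖w‖ ^ 2 ≤ 1 / 4 * ‖v‖ ^ 2 := by
      calc _ ≤ (4 * (entrySum (1 - M)⁻¹ + 1) ^ 2)⁻¹ *
            ((entrySum (1 - M)⁻¹ + 1) * ‖v‖) ^ 2 := by gcongr
        _ = _ := by field_simp
    linarith

/-- Stability is invariant under transposition, so the transpose of the stabilizing gain of the dual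
pair is an observer gain L. -/
lemma Detectable.exists_lyapunov {A : Matrix (Fin n) (Fin n) ℝ} {C : Matrix (Fin p) (Fin n) ℝ}
    (h : Detectable A C) : ∃ (L : Matrix (Fin n) (Fin p) ℝ) (X : Matrix (Fin n) (Fin n) ℝ),
      Xᵀ = X ∧ (∀ x : Fin n → ℝ, x ⬝ᵥ x ≤ x ⬝ᵥ X *ᵥ x) ∧
      ∃ c > 0, ∀ x : Fin n → ℝ, 2 * (x ⬝ᵥ X *ᵥ ((A - L * C) *ᵥ x)) ≤ -c * ‖x‖ ^ 2 := by
  obtain ⟨K, hK⟩ := h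
  refine ⟨Kᵀ, ?_⟩
  have := hK.transpose.exists_lyapunov
  simpa [Matrix.transpose_sub, Matrix.transpose_mul] using this

end LinearAlgebra

/-! ### Global solutions, exit-time arguments, integrals over the half line -/

section ODE

lemma exists_global_solution {E : Type*} [NormedAddCommGroup E] [NormedSpace ℝ E] [CompleteSpace E]
    {F : E → E} {K : NNReal} (hF : LipschitzWith K F) {C : NNReal} (hC : ∀ z, ‖F z‖ ≤ C) (x : E) :
    ∃ y : ℝ → E, y 0 = x ∧ ∀ t, 0 ≤ t → HasDerivWithinAt y (F (y t)) (Ici 0) t := by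
  have hloc : ∀ n : ℕ, ∃ α : ℝ → E, α 0 = x ∧
      ∀ t ∈ Icc (0 : ℝ) (n + 1), HasDerivWithinAt α (F (α t)) (Icc 0 (n + 1)) t := by
    intro n
    have hn : (0 : ℝ) ≤ n + 1 := by positivity
    -- The radius C(n + 1) is the largest distance that speed C allows in time n + 1, so the local
    -- theorem covers the whole interval.
    have hPL : IsPicardLindelof (fun _ => F) (tmin := 0) (tmax := n + 1) ⟨0, le_rfl, hn⟩ x
        (C * (n + 1)) 0 C K := by
      refine IsPicardLindelof.of_time_independent (fun z _ => hC z) hF.lipschitzOnWith ?_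
      simp [hn]
    exact hPL.exists_eq_forall_mem_Icc_hasDerivWithinAt₀
  choose α hα0 hα using hloc
  have heq : ∀ n k : ℕ, n ≤ k → EqOn (α n) (α k) (Icc 0 (n + 1)) := by
    intro n k hnk
    have hnk' : (n : ℝ) + 1 ≤ k + 1 := by
      have : (n : ℝ) ≤ k := by exact_mod_cast hnk
      linarith
    have key : ∀ j : ℕ, n ≤ j → ContinuousOn (α j) (Icc 0 (n + 1)) ∧
        ∀ t ∈ Ico (0 : ℝ) (n + 1), HasDerivWithinAt (α j) (F (α j t)) (Ici t) t := by
      intro j hj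
      have hj' : (n : ℝ) + 1 ≤ j + 1 := by
        have : (n : ℝ) ≤ j := by exact_mod_cast hj
        linarith
      refine ⟨fun t ht => ((hα j t ⟨ht.1, ht.2.trans hj'⟩).continuousWithinAt).mono
        (Icc_subset_Icc_right hj'), fun t ht => ?_⟩
      have h1 := (hα j t ⟨ht.1, ht.2.le.trans hj'⟩).mono
        (Icc_subset_Icc_left ht.1 : Icc t ((j : ℝ) + 1) ⊆ _)
      exact h1.mono_of_mem_nhdsWithin (Icc_mem_nhdsGE (ht.2.trans_le hj'))
    exact ODE_solution_unique (v := fun _ => F) (fun _ => hF) (key n le_rfl).1 (key n le_rfl).2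
      (key k hnk).1 (key k hnk).2 (by rw [hα0, hα0])
  refine ⟨fun t => α ⌈t⌉₊ t, by simp [hα0], fun t ht => ?_⟩
  -- Since t < N, the interval [0, N] is a neighbourhood of t in [0, ∞), and the glued function
  -- coincides with `α N` on it.
  set N := ⌈t⌉₊ + 1 with hN
  have htN : t < N := by
    have := Nat.le_ceil t
    push_cast [hN]
    linarith
  have hy : ∀ s ∈ Icc (0 : ℝ) N, α ⌈s⌉₊ s = α N s := by
    intro s hs
    refine heq _ _ (Nat.ceil_le.2 hs.2) ⟨hs.1, ?_⟩
    have := Nat.le_ceil s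
    linarith
  have h1 : HasDerivWithinAt (α N) (F (α N t)) (Icc 0 N) t :=
    (hα N t ⟨ht, by linarith⟩).mono (Icc_subset_Icc_right (by linarith))
  have h2 := h1.congr (f₁ := fun t => α ⌈t⌉₊ t) hy (hy t ⟨ht, htN.le⟩)
  rw [← hy t ⟨ht, htN.le⟩] at h2
  refine h2.mono_of_mem_nhdsWithin ?_
  rw [← Ici_inter_Iic]
  exact inter_mem self_mem_nhdsWithin (mem_nhdsWithin_of_mem_nhds (Iic_mem_nhds htN))

/-- A sup-norm ball is a cube, so clipping each coordinate is a 1-Lipschitz retraction onto it.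
Precomposing F with it gives a bounded, globally Lipschitz field. The derivative `y'` is only tied
to F inside the ball; a trapping argument must later show that the solution stays there. -/
lemma exists_solution_of_lipschitzOnWith {d : ℕ} {F : (Fin d → ℝ) → Fin d → ℝ} {ρ : ℝ}
    (hρ : 0 ≤ ρ) {K : NNReal} (hF : LipschitzOnWith K F (Metric.closedBall 0 ρ)) (x : Fin d → ℝ) :
    ∃ y : ℝ → Fin d → ℝ, y 0 = x ∧ ∃ y' : ℝ → Fin d → ℝ,
      (∀ t, 0 ≤ t → HasDerivWithinAt y (y' t) (Ici 0) t) ∧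
      ∀ t, ‖y t‖ ≤ ρ → y' t = F (y t) := by
  have hρ' : -ρ ≤ ρ := by linarith
  set pr : (Fin d → ℝ) → Fin d → ℝ := fun z i => (projIcc (-ρ) ρ hρ' (z i) : ℝ) with hpr
  have hprmem : ∀ z, pr z ∈ Metric.closedBall (0 : Fin d → ℝ) ρ := by
    intro z
    rw [mem_closedBall_zero_iff, pi_norm_le_iff_of_nonneg hρ]
    intro i
    rw [Real.norm_eq_abs, abs_le]
    exact (projIcc (-ρ) ρ hρ' (z i)).2
  have hprlip : LipschitzWith 1 pr := by
    refine LipschitzWith.of_dist_le_mul fun z w => ?_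
    rw [NNReal.coe_one, one_mul, dist_pi_le_iff dist_nonneg]
    intro i
    refine le_trans ?_ (dist_le_pi_dist z w i)
    have := (LipschitzWith.projIcc hρ').dist_le_mul (z i) (w i)
    rw [NNReal.coe_one, one_mul] at this
    exact this
  have hpreq : ∀ z, ‖z‖ ≤ ρ → pr z = z := by
    intro z hz
    ext i
    have : z i ∈ Icc (-ρ) ρ := by
      rw [mem_Icc, ← abs_le]
      exact (norm_le_pi_norm z i).trans hz
    simp [hpr, projIcc_of_mem hρ' this]
  have hlip : LipschitzWith K (F ∘ pr) := by
    have := hF.comp (hprlip.lipschitzOnWith (s := univ)) (fun z _ => hprmem z)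
    rw [lipschitzOnWith_univ, mul_one] at this
    exact this
  obtain ⟨C, hC⟩ := (isCompact_closedBall (0 : Fin d → ℝ) ρ).exists_bound_of_continuousOn
    hF.continuousOn
  obtain ⟨y, hy0, hy⟩ := exists_global_solution hlip (C := C.toNNReal)
    (fun z => (hC _ (hprmem z)).trans (Real.le_coe_toNNReal C)) x
  exact ⟨y, hy0, _, hy, fun t ht => by simp [hpreq _ ht]⟩

lemma forall_lt_of_first_exit {φ : ℝ → ℝ} {T ρ : ℝ} (hφ : ContinuousOn φ (Icc 0 T)) (h0 : φ 0 < ρ)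
    (h : ∀ t ∈ Icc 0 T, (∀ s ∈ Icc 0 t, φ s ≤ ρ) → φ t < ρ) : ∀ t ∈ Icc 0 T, φ t < ρ := by
  by_contra! hcon
  obtain ⟨t, ht, htρ⟩ := hcon
  have hclosed : IsClosed (Icc 0 T ∩ φ ⁻¹' Ici ρ) :=
    hφ.preimage_isClosed_of_isClosed isClosed_Icc isClosed_Ici
  have hcomp : IsCompact (Icc 0 T ∩ φ ⁻¹' Ici ρ) :=
    isCompact_Icc.of_isClosed_subset hclosed inter_subset_left
  obtain ⟨τ, ⟨hτT, hτρ⟩, hτ⟩ := hcomp.exists_isLeast ⟨t, ht, htρ⟩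
  have hlt : ∀ s ∈ Ico 0 τ, φ s ≤ ρ := by
    intro s hs
    by_contra! hc
    exact absurd (hτ ⟨⟨hs.1, hs.2.le.trans hτT.2⟩, hc.le⟩) (not_le.2 hs.2)
  have hτ0 : 0 < τ := by
    rcases hτT.1.eq_or_lt with he | hl
    · rw [mem_preimage, ← he, mem_Ici] at hτρ
      linarith
    · exact hl
  have hle : φ τ ≤ ρ := by
    refine ContinuousWithinAt.closure_le (s := Ico 0 τ) ?_ ?_ continuousWithinAt_const hlt
    · rw [closure_Ico hτ0.ne]
      exact ⟨hτ0.le, le_rfl⟩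
    · exact (hφ τ hτT).mono fun s hs => ⟨hs.1, hs.2.le.trans hτT.2⟩
  refine absurd (h τ hτT fun s hs => ?_) (not_lt.2 hτρ)
  rcases hs.2.eq_or_lt with he | hl
  · rwa [he]
  · exact hlt s ⟨hs.1, hl⟩

lemma intervalIntegrable_of_continuousOn_Ici {E : Type*} [NormedAddCommGroup E]
    {h : ℝ → E} (hc : ContinuousOn h (Ici 0)) {T : ℝ} (hT : 0 ≤ T) :
    IntervalIntegrable h volume 0 T :=
  (hc.mono (by rw [uIcc_of_le hT]; exact fun _ hs => hs.1)).intervalIntegrable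

lemma sub_le_integral_of_hasDerivWithinAt_Ici {g g' φ : ℝ → ℝ} {T : ℝ} (hT : 0 ≤ T)
    (hg : ∀ t ∈ Icc 0 T, HasDerivWithinAt g (g' t) (Ici 0) t)
    (hφ : ContinuousOn φ (Ici 0)) (hle : ∀ t ∈ Icc 0 T, g' t ≤ φ t) :
    g T - g 0 ≤ ∫ t in (0 : ℝ)..T, φ t := by
  refine intervalIntegral.sub_le_integral_of_hasDeriv_right_of_le hT
    (fun t ht => (hg t ht).continuousWithinAt.mono fun _ hs => hs.1)
    (fun t ht => (hg t ⟨ht.1.le, ht.2.le⟩).mono fun s hs => ht.1.le.trans (le_of_lt hs)) ?_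
    (fun t ht => hle t ⟨ht.1.le, ht.2.le⟩)
  exact (hφ.mono fun _ hs => hs.1).integrableOn_compact isCompact_Icc

/-- Bootstrap: the inequalities are known only while ‖y‖ ≤ ρ, but up to a first exit they keep a‖y‖²
≤ g ≤ g(0) < aρ², which rules the exit out. -/
lemma dissipation {E : Type*} [NormedAddCommGroup E] {y : ℝ → E} (hy : ContinuousOn y (Ici 0))
    {g g' : ℝ → ℝ} {ρ a c : ℝ} (ha : 0 < a) (hc : 0 ≤ c)
    (hg : ∀ t, 0 ≤ t → ‖y t‖ ≤ ρ →
      HasDerivWithinAt g (g' t) (Ici 0) t ∧ g' t ≤ -c * ‖y t‖ ^ 2 ∧ a * ‖y t‖ ^ 2 ≤ g t)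
    (h0 : ‖y 0‖ < ρ) (hg0 : g 0 < a * ρ ^ 2) :
    ∀ t, 0 ≤ t → ‖y t‖ < ρ ∧ c * ∫ s in (0 : ℝ)..t, ‖y s‖ ^ 2 ≤ g 0 := by
  have key : ∀ t, 0 ≤ t → (∀ s ∈ Icc 0 t, ‖y s‖ ≤ ρ) →
      g t + c * ∫ s in (0 : ℝ)..t, ‖y s‖ ^ 2 ≤ g 0 := by
    intro t ht hs
    have := sub_le_integral_of_hasDerivWithinAt_Ici ht (φ := fun s => -c * ‖y s‖ ^ 2)
      (fun s hs' => (hg s hs'.1 (hs s hs')).1) (by fun_prop)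
      (fun s hs' => (hg s hs'.1 (hs s hs')).2.1)
    rw [intervalIntegral.integral_const_mul] at this
    linarith
  have hpos : ∀ t, 0 ≤ t → 0 ≤ ∫ s in (0 : ℝ)..t, ‖y s‖ ^ 2 := fun t ht =>
    intervalIntegral.integral_nonneg ht fun _ _ => by positivity
  have htrap : ∀ t, 0 ≤ t → ‖y t‖ < ρ := by
    intro T hT
    refine forall_lt_of_first_exit (φ := fun t => ‖y t‖) (T := T)
      ((hy.mono fun _ hs => hs.1).norm) h0 (fun t ht hs => ?_) T ⟨hT, le_rfl⟩
    have h1 := key t ht.1 hs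
    have h2 := (hg t ht.1 (hs t ⟨ht.1, le_rfl⟩)).2.2
    have h3 := mul_nonneg hc (hpos t ht.1)
    have h4 : a * ‖y t‖ ^ 2 < a * ρ ^ 2 := by linarith
    exact lt_of_pow_lt_pow_left₀ 2 ((norm_nonneg _).trans h0.le) (lt_of_mul_lt_mul_left h4 ha.le)
  intro t ht
  refine ⟨htrap t ht, ?_⟩
  have h1 := key t ht fun s hs => (htrap s hs.1).le
  have h2 := (hg t ht (htrap t ht).le).2.2
  have : 0 ≤ a * ‖y t‖ ^ 2 := by positivity
  linarith

lemma integrableOn_of_intervalIntegral_le {h : ℝ → ℝ} (hc : ContinuousOn h (Ici 0))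
    (h0 : ∀ t, 0 ≤ t → 0 ≤ h t) {M : ℝ} (hM : ∀ T, 0 ≤ T → ∫ t in (0 : ℝ)..T, h t ≤ M) :
    IntegrableOn h (Ioi 0) := by
  refine integrableOn_Ioi_of_intervalIntegral_norm_bounded M 0 (b := fun T : ℝ => T) (l := atTop)
    (fun T => ?_) tendsto_id ?_
  · exact ((hc.mono fun _ hs => hs.1).integrableOn_compact isCompact_Icc).mono_set
      Ioc_subset_Icc_self
  · filter_upwards [eventually_ge_atTop 0] with T hT
    refine le_trans (le_of_eq ?_) (hM T hT)
    refine intervalIntegral.integral_congr fun t ht => ?_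
    rw [uIcc_of_le hT] at ht
    exact Real.norm_of_nonneg (h0 t ht.1)

lemma lintegral_ofReal_le {h : ℝ → ℝ} (hc : ContinuousOn h (Ici 0))
    (h0 : ∀ t, 0 ≤ t → 0 ≤ h t) {M : ℝ} (hM : ∀ T, 0 ≤ T → ∫ t in (0 : ℝ)..T, h t ≤ M) :
    ∫⁻ t in Ici (0 : ℝ), ENNReal.ofReal (h t) ≤ ENNReal.ofReal M := by
  have hint := integrableOn_of_intervalIntegral_le hc h0 hM
  have hle : ∫ t in Ioi (0 : ℝ), h t ≤ M :=
    le_of_tendsto (intervalIntegral_tendsto_integral_Ioi 0 hint tendsto_id)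
      ((eventually_ge_atTop 0).mono hM)
  rw [setLIntegral_congr Ioi_ae_eq_Ici.symm, ← ofReal_integral_eq_lintegral_ofReal hint
    (ae_restrict_of_forall_mem measurableSet_Ioi fun t ht => h0 t (le_of_lt ht))]
  exact ENNReal.ofReal_le_ofReal hle

lemma exists_lt_of_intervalIntegral_le {h : ℝ → ℝ} (hc : ContinuousOn h (Ici 0)) {M : ℝ}
    (hM : ∀ T, 0 ≤ T → ∫ t in (0 : ℝ)..T, h t ≤ M) {ε : ℝ} (hε : 0 < ε) :
    ∃ T, 0 ≤ T ∧ h T < ε := by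
  by_contra! hcon
  have hT : 0 ≤ (|M| + 1) / ε := by positivity
  have h1 : ∫ _t in (0 : ℝ)..(|M| + 1) / ε, ε ≤ ∫ t in (0 : ℝ)..(|M| + 1) / ε, h t :=
    intervalIntegral.integral_mono_on hT (by simp) (intervalIntegrable_of_continuousOn_Ici hc hT)
      fun t ht => hcon t ht.1
  have h2 := h1.trans (hM _ hT)
  rw [intervalIntegral.integral_const, smul_eq_mul, sub_zero, div_mul_cancel₀ _ hε.ne'] at h2
  linarith [le_abs_self M]

end ODE

/-! ### Classical trajectories as competitors for the value function -/

section Control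

variable {d m : ℕ} {f : (Fin d → ℝ) → Fin d → ℝ} {B : (Fin d → ℝ) → Matrix (Fin d) (Fin m) ℝ}
  {Q : Matrix (Fin d) (Fin d) ℝ} {R : Matrix (Fin m) (Fin m) ℝ}

lemma continuousOn_mulVec {X : Type*} [TopologicalSpace X] {n p : ℕ} {s : Set X}
    {M : X → Matrix (Fin n) (Fin p) ℝ} {v : X → Fin p → ℝ} (hM : ContinuousOn M s)
    (hv : ContinuousOn v s) : ContinuousOn (fun x => M x *ᵥ v x) s :=
  (continuous_fst.matrix_mulVec continuous_snd : Continuous fun q : Matrix (Fin n) (Fin p) ℝ ×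
    (Fin p → ℝ) => q.1 *ᵥ q.2).comp_continuousOn (f := fun x => (M x, v x)) (hM.prodMk hv)

lemma continuousOn_dotProduct {X : Type*} [TopologicalSpace X] {n : ℕ} {s : Set X}
    {v w : X → Fin n → ℝ} (hv : ContinuousOn v s)
    (hw : ContinuousOn w s) : ContinuousOn (fun x => v x ⬝ᵥ w x) s :=
  (continuous_fst.dotProduct continuous_snd : Continuous fun q : (Fin n → ℝ) ×
    (Fin n → ℝ) => q.1 ⬝ᵥ q.2).comp_continuousOn (f := fun x => (v x, w x)) (hv.prodMk hw)

lemma isControlled_of_hasDerivWithinAt (hf : Continuous f) (hB : Continuous B) {x : Fin d → ℝ}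
    {u : ℝ → Fin m → ℝ} {y : ℝ → Fin d → ℝ} (hy0 : y 0 = x)
    (hy : ∀ t, 0 ≤ t → HasDerivWithinAt y (f (y t) + B (y t) *ᵥ u t) (Ici 0) t)
    (hu : ContinuousOn u (Ici 0)) {C : ℝ} (hC : ∀ t, 0 ≤ t → ‖u t‖ ≤ C) :
    IsControlled f B x u y := by
  have hyc : ContinuousOn y (Ici 0) := fun t ht => (hy t ht).continuousWithinAt
  refine ⟨memLp_top_of_bound (hu.aestronglyMeasurable measurableSet_Ici) C
    (ae_restrict_of_forall_mem measurableSet_Ici hC), hyc, fun t ht => ?_⟩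
  have hcont : ContinuousOn (fun s => f (y s) + B (y s) *ᵥ u s) (Ici 0) := by
    have h1 : ContinuousOn (fun s => B (y s)) (Ici 0) := hB.comp_continuousOn hyc
    exact (hf.comp_continuousOn hyc).add (continuousOn_mulVec h1 hu)
  rw [intervalIntegral.integral_eq_sub_of_hasDeriv_right_of_le ht
    (hyc.mono fun _ hs => hs.1)
    (fun s hs => (hy s hs.1.le).mono fun r hr => hs.1.le.trans (le_of_lt hr))
    (intervalIntegrable_of_continuousOn_Ici hcont ht), hy0]
  abel

lemma runningCost_nonneg (hQ : Q.PosSemidef) (hR : R.PosDef) (x : Fin d → ℝ) (u : Fin m → ℝ) :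
    0 ≤ runningCost Q R x u :=
  add_nonneg (posSemidef_nonneg hQ x) (posSemidef_nonneg hR.posSemidef u)

lemma continuous_runningCost :
    Continuous fun p : (Fin d → ℝ) × (Fin m → ℝ) => runningCost Q R p.1 p.2 := by
  unfold runningCost
  exact (continuous_fst.dotProduct (continuous_const.matrix_mulVec continuous_fst)).add
    (continuous_snd.dotProduct (continuous_const.matrix_mulVec continuous_snd))

lemma continuousOn_runningCost {u : ℝ → Fin m → ℝ} {y : ℝ → Fin d → ℝ} {s : Set ℝ}
    (hy : ContinuousOn y s) (hu : ContinuousOn u s) :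
    ContinuousOn (fun t => runningCost Q R (y t) (u t)) s :=
  continuous_runningCost.comp_continuousOn (f := fun t => (y t, u t)) (hy.prodMk hu)

lemma valueENN_le {x : Fin d → ℝ} {u : ℝ → Fin m → ℝ} {y : ℝ → Fin d → ℝ}
    (h : IsControlled f B x u y) : valueENN f B Q R x ≤ cost Q R u y :=
  iInf_le_of_le u (iInf_le_of_le y (iInf_le _ h))

/-- A classical trajectory with continuous bounded control bounds the value function. -/
lemma valueENN_le_ofReal (hf : Continuous f) (hB : Continuous B) (hQ : Q.PosSemidef)
    (hR : R.PosDef) {x : Fin d → ℝ}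
    {u : ℝ → Fin m → ℝ} {y : ℝ → Fin d → ℝ} (hy0 : y 0 = x)
    (hy : ∀ t, 0 ≤ t → HasDerivWithinAt y (f (y t) + B (y t) *ᵥ u t) (Ici 0) t)
    (hu : ContinuousOn u (Ici 0)) {C : ℝ} (hC : ∀ t, 0 ≤ t → ‖u t‖ ≤ C) {M : ℝ}
    (hM : ∀ T, 0 ≤ T → ∫ t in (0 : ℝ)..T, runningCost Q R (y t) (u t) ≤ M) :
    valueENN f B Q R x ≤ ENNReal.ofReal M :=
  (valueENN_le (isControlled_of_hasDerivWithinAt hf hB hy0 hy hu hC)).trans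
    (lintegral_ofReal_le (continuousOn_runningCost (fun t ht => (hy t ht).continuousWithinAt) hu)
      (fun _ _ => runningCost_nonneg hQ hR _ _) hM)

lemma value_nonneg (x : Fin d → ℝ) : 0 ≤ value f B Q R x := ENNReal.toReal_nonneg

end Control

/-! ### Detectability, smallness of the residual, and trapping near the origin -/

section Local

variable {d m : ℕ} {f : (Fin d → ℝ) → Fin d → ℝ} {B : (Fin d → ℝ) → Matrix (Fin d) (Fin m) ℝ}
  {Q : Matrix (Fin d) (Fin d) ℝ} {R : Matrix (Fin m) (Fin m) ℝ}
  {A P : (Fin d → ℝ) → Matrix (Fin d) (Fin d) ℝ}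

lemma eventually_nhds_zero_iff {E : Type*} [NormedAddCommGroup E] {p : E → Prop} :
    (∀ᶠ z in 𝓝 0, p z) ↔ ∃ ρ > 0, ∀ z, ‖z‖ ≤ ρ → p z := by
  simp [Metric.nhds_basis_closedBall.eventually_iff]

lemma sqrt_dotProduct (hQ : Q.PosSemidef) (x : Fin d → ℝ) :
    (CFC.sqrt Q *ᵥ x) ⬝ᵥ (CFC.sqrt Q *ᵥ x) = x ⬝ᵥ Q *ᵥ x := by
  have h1 : CFC.sqrt Q * CFC.sqrt Q = Q := CFC.sqrt_mul_sqrt_self Q hQ.nonneg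
  have h2 : (CFC.sqrt Q)ᵀ = CFC.sqrt Q :=
    transpose_eq_of_isHermitian (Matrix.nonneg_iff_posSemidef.1 (CFC.sqrt_nonneg Q)).isHermitian
  rw [dotProduct_mulVec_comm h2, Matrix.mulVec_mulVec, h1]

lemma eventually_entrySum_sub_lt {a b : ℕ} {M : (Fin d → ℝ) → Matrix (Fin a) (Fin b) ℝ}
    (hM : ContinuousAt M 0) {ε : ℝ} (hε : 0 < ε) : ∀ᶠ z in 𝓝 0, entrySum (M z - M 0) < ε := by
  have h : ContinuousAt (fun z => entrySum (M z - M 0)) 0 :=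
    continuous_entrySum.continuousAt.comp (hM.sub continuousAt_const)
  exact h.eventually_lt_const (by simpa using hε)

lemma eventually_entrySum_lt {a b : ℕ} {M : (Fin d → ℝ) → Matrix (Fin a) (Fin b) ℝ}
    (hM : ContinuousAt M 0) : ∀ᶠ z in 𝓝 0, entrySum (M z) < entrySum (M 0) + 1 :=
  (continuous_entrySum.continuousAt.comp hM).eventually_lt_const (by simp)

/-- Young's inequality: the two cross terms use c/8 each and the η-term c/4, which leaves half of
the decay. The summand 1 in the coefficient makes it strictly positive. -/
lemma lyapunov_estimate {N a l b c r η z q u : ℝ} (hc : 0 < c) (hr : 0 < r)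
    (hη : a * η ≤ c / 4)
    (hN : N ≤ -c * z ^ 2 + a * z * (η * z + l * q + b * u)) :
    N ≤ -(c / 2) * z ^ 2 +
      (2 * (a * l) ^ 2 / c + 2 * (a * b) ^ 2 / c / r + 1) * (q ^ 2 + r * u ^ 2) := by
  have h1 : a * l * z * q ≤ c / 8 * z ^ 2 + 2 * (a * l) ^ 2 / c * q ^ 2 := by
    have : c / 8 * z ^ 2 + 2 * (a * l) ^ 2 / c * q ^ 2 - a * l * z * q =
        (c * z - 4 * (a * l) * q) ^ 2 / (8 * c) := by field_simp; ring
    have h2 : 0 ≤ (c * z - 4 * (a * l) * q) ^ 2 / (8 * c) := by positivity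
    linarith
  have h2 : a * b * z * u ≤ c / 8 * z ^ 2 + 2 * (a * b) ^ 2 / c * u ^ 2 := by
    have : c / 8 * z ^ 2 + 2 * (a * b) ^ 2 / c * u ^ 2 - a * b * z * u =
        (c * z - 4 * (a * b) * u) ^ 2 / (8 * c) := by field_simp; ring
    have h2 : 0 ≤ (c * z - 4 * (a * b) * u) ^ 2 / (8 * c) := by positivity
    linarith
  have h3 : a * η * z ^ 2 ≤ c / 4 * z ^ 2 := by gcongr
  have e : (2 * (a * l) ^ 2 / c + 2 * (a * b) ^ 2 / c / r + 1) * (q ^ 2 + r * u ^ 2) =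
      2 * (a * l) ^ 2 / c * q ^ 2 + 2 * (a * b) ^ 2 / c * u ^ 2 +
      (2 * (a * l) ^ 2 / c * (r * u ^ 2) + 2 * (a * b) ^ 2 / c / r * q ^ 2
        + (q ^ 2 + r * u ^ 2)) := by
    field_simp; ring
  have h4 : 0 ≤ 2 * (a * l) ^ 2 / c * (r * u ^ 2) + 2 * (a * b) ^ 2 / c / r * q ^ 2
        + (q ^ 2 + r * u ^ 2) := by positivity
  rw [e]
  nlinarith

/-- Detectability provides a quadratic function that decreases along every controlled trajectory
up to a multiple of the running cost. -/
lemma exists_detectability_lyapunov (hQ : Q.PosSemidef) (hR : R.PosDef)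
    (hA : ContinuousAt A 0) (hB : ContinuousAt B 0) (hfA : ∀ᶠ x in 𝓝 0, f x = A x *ᵥ x)
    (hdet : Detectable (A 0) (CFC.sqrt Q)) :
    ∃ X : Matrix (Fin d) (Fin d) ℝ, Xᵀ = X ∧ (∀ x : Fin d → ℝ, x ⬝ᵥ x ≤ x ⬝ᵥ X *ᵥ x) ∧
      ∃ c > 0, ∃ κ > 0, ∀ᶠ z in 𝓝 (0 : Fin d → ℝ), ∀ u : Fin m → ℝ,
        2 * (z ⬝ᵥ X *ᵥ (f z + B z *ᵥ u)) ≤ -c * ‖z‖ ^ 2 + κ * runningCost Q R z u := by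
  obtain ⟨L, X, hXT, hX, c, hc, hXc⟩ := hdet.exists_lyapunov
  obtain ⟨r, hr, hRr⟩ := exists_pos_le_of_posDef hR
  set a : ℝ := 2 * (d * entrySum X) with ha
  have ha0 : 0 ≤ a := by have := entrySum_nonneg X; positivity
  set l := entrySum L
  set b := entrySum (B 0) + 1
  refine ⟨X, hXT, hX, c / 2, by positivity,
    2 * (a * l) ^ 2 / c + 2 * (a * b) ^ 2 / c / r + 1, by positivity, ?_⟩
  -- The 1 in the denominator covers the case a = 0.
  set η : ℝ := c / (4 * (a + 1)) with hη
  have hη0 : 0 < η := by positivity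
  have haη : a * η ≤ c / 4 := by
    rw [hη, mul_div_assoc', div_le_div_iff₀ (by positivity) (by norm_num)]
    nlinarith
  filter_upwards [hfA, eventually_entrySum_sub_lt hA hη0, eventually_entrySum_lt hB]
    with z hfz hAz hBz u
  set q := ‖CFC.sqrt Q *ᵥ z‖ with hq
  have hcost : q ^ 2 + r * ‖u‖ ^ 2 ≤ runningCost Q R z u := by
    refine add_le_add ?_ (hRr u)
    rw [← sqrt_dotProduct hQ]
    exact norm_sq_le_dotProduct _
  -- The stable observer matrix drives z up to `w`, whose parts are small near 0, controlled by the
  -- state cost, and controlled by the control cost.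
  set w := (A z - A 0) *ᵥ z + L *ᵥ (CFC.sqrt Q *ᵥ z) + B z *ᵥ u with hw
  have hsplit : f z + B z *ᵥ u = (A 0 - L * CFC.sqrt Q) *ᵥ z + w := by
    rw [hfz, hw, Matrix.sub_mulVec, Matrix.sub_mulVec, ← Matrix.mulVec_mulVec]
    abel
  have hwn : ‖w‖ ≤ η * ‖z‖ + l * q + b * ‖u‖ := by
    refine (norm_add₃_le).trans ?_
    gcongr
    · exact (norm_mulVec_le _ _).trans (by gcongr)
    · exact norm_mulVec_le _ _
    · exact (norm_mulVec_le _ _).trans (by gcongr)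
  refine (lyapunov_estimate (a := a) (l := l) (b := b) (q := q) (u := ‖u‖) (z := ‖z‖)
    hc hr haη ?_).trans ?_
  · rw [hsplit, Matrix.mulVec_add, dotProduct_add, mul_add]
    refine add_le_add (hXc z) ?_
    have h1 := (le_abs_self _).trans (abs_dotProduct_mulVec_le X z w)
    calc 2 * (z ⬝ᵥ X *ᵥ w) ≤ 2 * (d * entrySum X * ‖z‖ * ‖w‖) := by linarith
      _ = a * ‖z‖ * ‖w‖ := by rw [ha]; ring
      _ ≤ _ := by gcongr
  · gcongr

lemma grad_dotProduct (W : (Fin d → ℝ) → ℝ) (x v : Fin d → ℝ) :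
    grad W x ⬝ᵥ v = fderiv ℝ W x v := by
  conv_rhs => rw [pi_eq_sum_univ' v]
  simp [dotProduct, grad, mul_comm]

lemma hasFDerivAt_valueS {z : Fin d → ℝ} (hP : ∀ i j, DifferentiableAt ℝ (fun x => P x i j) z) :
    ∃ L : (Fin d → ℝ) →L[ℝ] ℝ, HasFDerivAt (valueS P) L z ∧ ∀ v, L v = v ⬝ᵥ P z *ᵥ z +
      z ⬝ᵥ P z *ᵥ v + ∑ i, z i * ∑ j, fderiv ℝ (fun x => P x i j) z v * z j := by
  have h : ∀ i, HasFDerivAt (fun x : Fin d → ℝ => ∑ j, P x i j * x j) _ z := fun i =>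
    HasFDerivAt.fun_sum (u := Finset.univ) fun j _ =>
      (hP i j).hasFDerivAt.fun_mul (hasFDerivAt_apply j z)
  have h' : HasFDerivAt (fun x : Fin d → ℝ => ∑ i, x i * ∑ j, P x i j * x j) _ z :=
    HasFDerivAt.fun_sum (u := Finset.univ) fun i _ => (hasFDerivAt_apply i z).fun_mul (h i)
  refine ⟨_, h', fun v => ?_⟩
  simp only [dotProduct, Matrix.mulVec, ← Finset.sum_add_distrib, _root_.sum_apply,
    _root_.add_apply, _root_.smul_apply, smul_eq_mul,
    ContinuousLinearMap.proj_apply, Finset.mul_sum, Finset.sum_mul]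
  refine Finset.sum_congr rfl fun i _ => Finset.sum_congr rfl fun j _ => ?_
  ring

lemma differentiableAt_valueS {z : Fin d → ℝ}
    (hP : ∀ i j, DifferentiableAt ℝ (fun x => P x i j) z) : DifferentiableAt ℝ (valueS P) z := by
  obtain ⟨L, hL, -⟩ := hasFDerivAt_valueS hP
  exact hL.differentiableAt

lemma hasDerivWithinAt_quadratic {X : Matrix (Fin d) (Fin d) ℝ} (hX : Xᵀ = X)
    {y : ℝ → Fin d → ℝ} {y' : Fin d → ℝ} {s : Set ℝ} {t : ℝ} (hy : HasDerivWithinAt y y' s t) :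
    HasDerivWithinAt (fun t => y t ⬝ᵥ X *ᵥ y t) (2 * (y t ⬝ᵥ X *ᵥ y')) s t := by
  obtain ⟨L, hL, hLv⟩ := hasFDerivAt_valueS (P := fun _ => X) (z := y t)
    (fun i j => differentiableAt_const _)
  have := hL.comp_hasDerivWithinAt t hy
  refine this.congr_deriv ?_
  rw [hLv, dotProduct_mulVec_comm hX y' (y t)]
  simp
  ring

/-- By the product rule the discrepancy is zᵀ(∂P)z, and ∂P is bounded near 0. -/
lemma norm_grad_valueS_sub_le {O : Set (Fin d → ℝ)} (hO : O ∈ 𝓝 0) (hPT : ∀ x ∈ O, (P x)ᵀ = P x)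
    (hP : ∀ i j, ContDiffAt ℝ 1 (fun x => P x i j) 0) :
    ∃ K, 0 ≤ K ∧ ∀ᶠ z in 𝓝 (0 : Fin d → ℝ),
      ‖grad (valueS P) z - (2 : ℝ) • (P z *ᵥ z)‖ ≤ K * ‖z‖ ^ 2 := by
  have hbound : ∀ i j, ∀ᶠ z in 𝓝 (0 : Fin d → ℝ), ‖fderiv ℝ (fun x => P x i j) z‖ <
      ‖fderiv ℝ (fun x => P x i j) 0‖ + 1 := fun i j =>
    ((hP i j).continuousAt_fderiv one_ne_zero).norm.eventually_lt_const (by simp)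
  have hdiff : ∀ i j, ∀ᶠ z in 𝓝 (0 : Fin d → ℝ), DifferentiableAt ℝ (fun x => P x i j) z :=
    fun i j => ((hP i j).eventually (by simp)).mono fun z hz => hz.differentiableAt one_ne_zero
  refine ⟨∑ i, ∑ j, (‖fderiv ℝ (fun x => P x i j) 0‖ + 1), by positivity, ?_⟩
  filter_upwards [hO, eventually_all.2 fun i => eventually_all.2 (hbound i),
    eventually_all.2 fun i => eventually_all.2 (hdiff i)] with z hzO hzb hzd
  refine (pi_norm_le_iff_of_nonneg (by positivity)).2 fun k => ?_
  obtain ⟨L, hL, hLv⟩ := hasFDerivAt_valueS hzd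
  have h1 : (grad (valueS P) z - (2 : ℝ) • (P z *ᵥ z)) k =
      ∑ i, z i * ∑ j, fderiv ℝ (fun x => P x i j) z (Pi.single k 1) * z j := by
    simp only [Pi.sub_apply, grad, hL.fderiv, hLv]
    rw [dotProduct_mulVec_comm (hPT z hzO) z]
    simp
    ring
  rw [h1, Finset.sum_mul]
  refine (norm_sum_le _ _).trans (Finset.sum_le_sum fun i _ => ?_)
  rw [Finset.mul_sum, Finset.sum_mul]
  refine (norm_sum_le _ _).trans (Finset.sum_le_sum fun j _ => ?_)
  have h2 : ‖fderiv ℝ (fun x => P x i j) z (Pi.single k 1)‖ ≤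
      ‖fderiv ℝ (fun x => P x i j) 0‖ + 1 := by
    refine (ContinuousLinearMap.le_opNorm _ _).trans ?_
    rw [Pi.norm_single, norm_one, mul_one]
    exact (hzb i j).le
  calc ‖z i * (fderiv ℝ (fun x => P x i j) z (Pi.single k 1) * z j)‖
      = ‖z i‖ * (‖fderiv ℝ (fun x => P x i j) z (Pi.single k 1)‖ * ‖z j‖) := by
        rw [norm_mul, norm_mul]
    _ ≤ ‖z‖ * ((‖fderiv ℝ (fun x => P x i j) 0‖ + 1) * ‖z‖) := by
        gcongr <;> exact norm_le_pi_norm z _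
    _ = _ := by ring

/-- The terms free of r form the quadratic form of the Riccati expression, which vanishes. -/
lemma residual_identity {S A P Q : Matrix (Fin d) (Fin d) ℝ} (hS : Sᵀ = S) (hP : Pᵀ = P)
    (hric : Aᵀ * P + P * A - P * S * P + Q = 0) (z r : Fin d → ℝ) :
    ((2 : ℝ) • (P *ᵥ z) + r) ⬝ᵥ A *ᵥ z - (1 / 4 : ℝ) * (((2 : ℝ) • (P *ᵥ z) + r) ⬝ᵥ S *ᵥ
      ((2 : ℝ) • (P *ᵥ z) + r)) + z ⬝ᵥ Q *ᵥ z =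
    r ⬝ᵥ A *ᵥ z - r ⬝ᵥ (S * P) *ᵥ z - (1 / 4 : ℝ) * (r ⬝ᵥ S *ᵥ r) := by
  have h1 : z ⬝ᵥ (Aᵀ * P + P * A - P * S * P + Q) *ᵥ z = 0 := by simp [hric]
  have h2 : z ⬝ᵥ (Aᵀ * P) *ᵥ z = (P *ᵥ z) ⬝ᵥ A *ᵥ z := by
    rw [← Matrix.mulVec_mulVec, Matrix.dotProduct_mulVec, Matrix.vecMul_transpose, dotProduct_comm]
  have h3 : ∀ v, z ⬝ᵥ P *ᵥ v = (P *ᵥ z) ⬝ᵥ v := fun v => by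
    rw [dotProduct_mulVec_comm hP, dotProduct_comm]
  simp only [Matrix.add_mulVec, Matrix.sub_mulVec, dotProduct_add, dotProduct_sub, h2] at h1
  rw [Matrix.mul_assoc, ← Matrix.mulVec_mulVec, ← Matrix.mulVec_mulVec, ← Matrix.mulVec_mulVec,
    h3, h3] at h1
  simp only [Matrix.mulVec_add, Matrix.mulVec_smul, dotProduct_add, add_dotProduct,
    smul_dotProduct, dotProduct_smul, smul_eq_mul, ← Matrix.mulVec_mulVec]
  rw [dotProduct_mulVec_comm hS (P *ᵥ z) r]
  linarith

lemma transpose_gramian (hR : R.PosDef) (B : Matrix (Fin d) (Fin m) ℝ) :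
    (B * R⁻¹ * Bᵀ)ᵀ = B * R⁻¹ * Bᵀ := by
  rw [Matrix.transpose_mul, Matrix.transpose_mul, Matrix.transpose_transpose,
    Matrix.transpose_nonsing_inv, transpose_eq_of_isHermitian hR.isHermitian, Matrix.mul_assoc]

/-- In `residual_identity` r is of second order, so every surviving term is at least cubic.
Arbitrary ε is what lets the residual be absorbed by the Lyapunov decay. -/
lemma hjbResidual_valueS_le {O : Set (Fin d → ℝ)} (hO : O ∈ 𝓝 0) (hR : R.PosDef)
    (hA : ContinuousAt A 0) (hB : ContinuousAt B 0) (hfA : ∀ x ∈ O, f x = A x *ᵥ x)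
    (hPT : ∀ x ∈ O, (P x)ᵀ = P x) (hPric : ∀ x ∈ O, SolvesRiccati (A x) (B x) Q R (P x))
    (hP : ∀ i j, ContDiffAt ℝ 1 (fun x => P x i j) 0) {ε : ℝ} (hε : 0 < ε) :
    ∀ᶠ z in 𝓝 (0 : Fin d → ℝ), |hjbResidual f B Q R (valueS P) z| ≤ ε * ‖z‖ ^ 2 := by
  obtain ⟨K, hK0, hK⟩ := norm_grad_valueS_sub_le hO hPT hP
  have hPc : ContinuousAt P 0 :=
    continuousAt_pi.2 fun i => continuousAt_pi.2 fun j => (hP i j).continuousAt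
  have hSc : ContinuousAt (fun z => B z * R⁻¹ * (B z)ᵀ) 0 := by
    have : Continuous fun M : Matrix (Fin d) (Fin m) ℝ => M * R⁻¹ * Mᵀ := by fun_prop
    exact this.continuousAt.comp hB
  have hSPc : ContinuousAt (fun z => B z * R⁻¹ * (B z)ᵀ * P z) 0 := by
    have : Continuous fun M : Matrix (Fin d) (Fin d) ℝ × Matrix (Fin d) (Fin d) ℝ => M.1 * M.2 := by
      fun_prop
    exact this.continuousAt.comp (hSc.prodMk hPc)
  set α := entrySum (A 0) + 1
  set σ := entrySum (B 0 * R⁻¹ * (B 0)ᵀ) + 1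
  set τ := entrySum (B 0 * R⁻¹ * (B 0)ᵀ * P 0) + 1
  have hα : 0 ≤ α := by have := entrySum_nonneg (A 0); positivity
  have hσ : 0 ≤ σ := by have := entrySum_nonneg (B 0 * R⁻¹ * (B 0)ᵀ); positivity
  have hτ : 0 ≤ τ := by have := entrySum_nonneg (B 0 * R⁻¹ * (B 0)ᵀ * P 0); positivity
  set M : ℝ := d * K * (α + τ + σ * K)
  have hM : 0 ≤ M := by positivity
  have hsmall : ∀ᶠ z in 𝓝 (0 : Fin d → ℝ), ‖z‖ < min 1 (ε / (M + 1)) :=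
    continuous_norm.continuousAt.eventually_lt_const (by simp only [norm_zero]; positivity)
  filter_upwards [hO, hK, eventually_entrySum_lt hA, eventually_entrySum_lt hSc,
    eventually_entrySum_lt hSPc, hsmall] with z hzO hr hAz hSz hSPz hz
  set r := grad (valueS P) z - (2 : ℝ) • (P z *ᵥ z) with hrdef
  have hgrad : grad (valueS P) z = (2 : ℝ) • (P z *ᵥ z) + r := by rw [hrdef]; abel
  have hric : (A z)ᵀ * P z + P z * A z - P z * (B z * R⁻¹ * (B z)ᵀ) * P z + Q = 0 := by
    have := hPric z hzO
    unfold SolvesRiccati at this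
    simpa only [Matrix.mul_assoc] using this
  rw [hjbResidual, hfA z hzO, hgrad, residual_identity (transpose_gramian hR _) (hPT z hzO) hric]
  have b1 : |r ⬝ᵥ A z *ᵥ z| ≤ d * α * (K * ‖z‖ ^ 2) * ‖z‖ :=
    (abs_dotProduct_mulVec_le _ _ _).trans (by gcongr)
  have b2 : |r ⬝ᵥ (B z * R⁻¹ * (B z)ᵀ * P z) *ᵥ z| ≤ d * τ * (K * ‖z‖ ^ 2) * ‖z‖ :=
    (abs_dotProduct_mulVec_le _ _ _).trans (by gcongr)
  have hz1 : ‖z‖ ≤ 1 := hz.le.trans (min_le_left _ _)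
  have b3 : |r ⬝ᵥ (B z * R⁻¹ * (B z)ᵀ) *ᵥ r| ≤ d * σ * (K * ‖z‖ ^ 2) * (K * ‖z‖) := by
    refine (abs_dotProduct_mulVec_le _ _ _).trans ?_
    have : K * ‖z‖ ^ 2 ≤ K * ‖z‖ := by
      gcongr
      nlinarith [norm_nonneg z]
    gcongr
    exact hr.trans this
  have b3' : |(1 / 4 : ℝ) * (r ⬝ᵥ (B z * R⁻¹ * (B z)ᵀ) *ᵥ r)| ≤
      d * σ * (K * ‖z‖ ^ 2) * (K * ‖z‖) := by
    rw [abs_mul, abs_of_pos (by norm_num : (0 : ℝ) < 1 / 4)]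
    linarith [abs_nonneg (r ⬝ᵥ (B z * R⁻¹ * (B z)ᵀ) *ᵥ r)]
  have hMz : M * ‖z‖ ≤ ε := by
    have h1 : ‖z‖ ≤ ε / (M + 1) := hz.le.trans (min_le_right _ _)
    rw [le_div_iff₀ (by positivity)] at h1
    nlinarith [norm_nonneg z]
  calc _ ≤ d * α * (K * ‖z‖ ^ 2) * ‖z‖ + d * τ * (K * ‖z‖ ^ 2) * ‖z‖ +
        d * σ * (K * ‖z‖ ^ 2) * (K * ‖z‖) :=
        (abs_sub _ _).trans (add_le_add ((abs_sub _ _).trans (add_le_add b1 b2)) b3')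
    _ = M * ‖z‖ * ‖z‖ ^ 2 := by ring
    _ ≤ _ := by gcongr

lemma abs_valueS_le (hPc : ContinuousAt P 0) :
    ∀ᶠ z in 𝓝 (0 : Fin d → ℝ), |valueS P z| ≤ d * (entrySum (P 0) + 1) * ‖z‖ ^ 2 := by
  filter_upwards [eventually_entrySum_lt hPc] with z hz
  refine (abs_dotProduct_mulVec_le _ _ _).trans ?_
  rw [mul_assoc _ ‖z‖, ← sq]
  gcongr

/-- Trajectories of a feedback that dissipates the running cost through a storage function `U`
remain near the origin and are square integrable. -/
lemma exists_trapping (hQ : Q.PosSemidef) (hR : R.PosDef)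
    (hA : ContinuousAt A 0) (hB : ContinuousAt B 0) (hfA : ∀ᶠ x in 𝓝 0, f x = A x *ᵥ x)
    (hdet : Detectable (A 0) (CFC.sqrt Q)) :
    ∃ ε > 0, ∀ (U : (Fin d → ℝ) → ℝ) (k : (Fin d → ℝ) → Fin m → ℝ) (C : ℝ),
      (∀ᶠ z in 𝓝 0, DifferentiableAt ℝ U z ∧ 0 ≤ U z ∧ U z ≤ C * ‖z‖ ^ 2) →
      (∀ᶠ z in 𝓝 0, fderiv ℝ U z (f z + B z *ᵥ k z) ≤
        -runningCost Q R z (k z) + ε * ‖z‖ ^ 2) →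
      ∀ ρ > 0, ∃ C' : ℝ, ∀ᶠ x in 𝓝 (0 : Fin d → ℝ), ∀ y y' : ℝ → Fin d → ℝ, y 0 = x →
        (∀ t, 0 ≤ t → HasDerivWithinAt y (y' t) (Ici 0) t) →
        (∀ t, 0 ≤ t → ‖y t‖ ≤ ρ → y' t = f (y t) + B (y t) *ᵥ k (y t)) →
        ∀ t, 0 ≤ t → ‖y t‖ < ρ ∧ ∫ s in (0 : ℝ)..t, ‖y s‖ ^ 2 ≤ C' * ‖x‖ ^ 2 := by
  obtain ⟨X, hXT, hX, c, hc, κ, hκ, hL⟩ := exists_detectability_lyapunov hQ hR hA hB hfA hdet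
  -- With this ε, adding κU to the quadratic form cancels κ times the running cost and leaves the
  -- decay -(c/2)‖y‖². It does not depend on U or k.
  refine ⟨c / (2 * κ), by positivity, fun U k C hU hdec ρ hρ => ?_⟩
  obtain ⟨ρ', hρ', hall⟩ := eventually_nhds_zero_iff.1 (hL.and (hU.and hdec))
  set ρ₀ := min ρ ρ'
  have hρ₀ : 0 < ρ₀ := lt_min hρ hρ'
  set D : ℝ := d * entrySum X + κ * C
  have hD : ∀ x, ‖x‖ ≤ ρ' → x ⬝ᵥ X *ᵥ x + κ * U x ≤ D * ‖x‖ ^ 2 := by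
    intro x hx
    have h1 := (le_abs_self _).trans (abs_dotProduct_mulVec_le X x x)
    have h2 := mul_le_mul_of_nonneg_left (hall x hx).2.1.2.2 hκ.le
    calc _ ≤ d * entrySum X * ‖x‖ * ‖x‖ + κ * (C * ‖x‖ ^ 2) := add_le_add h1 h2
      _ = _ := by ring
  refine ⟨2 / c * D, ?_⟩
  have hcont : ContinuousAt (fun x : Fin d → ℝ => D * ‖x‖ ^ 2) 0 := by fun_prop
  filter_upwards [hcont.eventually_lt_const (u := ρ₀ ^ 2) (by simpa using by positivity),
    (continuous_norm (E := Fin d → ℝ)).continuousAt.eventually_lt_const (u := ρ₀)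
      (by simpa using hρ₀)] with x hxD hxρ y y' hy0 hy hy' t ht
  have hdis := dissipation (y := y) (fun t ht => (hy t ht).continuousWithinAt)
    (g := fun t => y t ⬝ᵥ X *ᵥ y t + κ * U (y t))
    (g' := fun t => 2 * (y t ⬝ᵥ X *ᵥ y' t) + κ * fderiv ℝ U (y t) (y' t))
    (ρ := ρ₀) (a := 1) (c := c / 2) one_pos (by positivity) (fun t ht htρ => ?_)
    (by rw [hy0]; exact hxρ)
    (by
      rw [hy0, one_mul]
      exact (hD x (hxρ.le.trans (min_le_right _ _))).trans_lt hxD) t ht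
  · refine ⟨hdis.1.trans_le (min_le_left _ _), ?_⟩
    have h1 := hdis.2
    simp only [hy0] at h1
    have h2 := h1.trans (hD x (hxρ.le.trans (min_le_right _ _)))
    calc ∫ s in (0 : ℝ)..t, ‖y s‖ ^ 2 = 2 / c * (c / 2 * ∫ s in (0 : ℝ)..t, ‖y s‖ ^ 2) := by
          field_simp
      _ ≤ 2 / c * (D * ‖x‖ ^ 2) := by gcongr
      _ = _ := by ring
  · obtain ⟨h1, ⟨h2, h3, -⟩, h4⟩ := hall (y t) (htρ.trans (min_le_right _ _))
    have hyt := hy' t ht (htρ.trans (min_le_left _ _))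
    refine ⟨(hasDerivWithinAt_quadratic hXT (hy t ht)).add
      ((h2.hasFDerivAt.comp_hasDerivWithinAt t (hy t ht)).const_mul κ), ?_, ?_⟩
    · have h5 := h1 (k (y t))
      have h6 := mul_le_mul_of_nonneg_left h4 hκ.le
      simp only [hyt]
      have h7 : κ * (c / (2 * κ) * ‖y t‖ ^ 2) = c / 2 * ‖y t‖ ^ 2 := by field_simp
      rw [mul_add, h7] at h6
      linarith
    · have h5 := (norm_sq_le_dotProduct (y t)).trans (hX (y t))
      have h6 := mul_nonneg hκ.le h3
      simp only [one_mul]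
      linarith

end Local

/-! ### Dynamic programming and the supersolution property of V -/

section HJB

variable {d m : ℕ} {f : (Fin d → ℝ) → Fin d → ℝ} {B : (Fin d → ℝ) → Matrix (Fin d) (Fin m) ℝ}
  {Q : Matrix (Fin d) (Fin d) ℝ} {R : Matrix (Fin m) (Fin m) ℝ}

/-- Purely algebraic: differentiability of W plays no role, as `grad` is defined through `fderiv`.
-/
lemma fderiv_controlled (hR : R.PosDef) (W : (Fin d → ℝ) → ℝ) (z : Fin d → ℝ) (u : Fin m → ℝ) :
    fderiv ℝ W z (f z + B z *ᵥ u) = -runningCost Q R z u + hjbResidual f B Q R W z +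
      (u - feedback B R W z) ⬝ᵥ R *ᵥ (u - feedback B R W z) := by
  have h := completing_square (B z) (Q := Q) hR (grad W z) (f z) z u
  rw [grad_dotProduct] at h
  have h' : minControl (B z) R (grad W z) = feedback B R W z := rfl
  rw [h'] at h
  unfold hjbResidual
  linarith

lemma fderiv_closedLoop (hR : R.PosDef) (W : (Fin d → ℝ) → ℝ) (z : Fin d → ℝ) :
    fderiv ℝ W z (f z + B z *ᵥ feedback B R W z) =
      -runningCost Q R z (feedback B R W z) + hjbResidual f B Q R W z := by
  simp [fderiv_controlled (Q := Q) hR]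

lemma IsControlled.exists_bound {x : Fin d → ℝ} {u : ℝ → Fin m → ℝ} {y : ℝ → Fin d → ℝ}
    (h : IsControlled f B x u y) : ∃ C : ℝ, ∀ᵐ s ∂volume.restrict (Ici (0 : ℝ)), ‖u s‖ ≤ C := by
  refine ⟨(eLpNorm u ∞ (volume.restrict (Ici 0))).toReal, ?_⟩
  have hfin := h.control_memLp.eLpNorm_ne_top
  rw [eLpNorm_exponent_top] at hfin ⊢
  filter_upwards [enorm_ae_le_eLpNormEssSup u (volume.restrict (Ici 0))] with s hs
  rw [← toReal_enorm]
  exact ENNReal.toReal_mono hfin hs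

/-- On a bounded time interval (y, u) lies almost everywhere in a compact set, where Φ is bounded.
-/
lemma IsControlled.integrableOn {x : Fin d → ℝ} {u : ℝ → Fin m → ℝ} {y : ℝ → Fin d → ℝ}
    (h : IsControlled f B x u y) {E : Type*} [NormedAddCommGroup E]
    {Φ : (Fin d → ℝ) × (Fin m → ℝ) → E} (hΦ : Continuous Φ) (T : ℝ) :
    IntegrableOn (fun s => Φ (y s, u s)) (Icc 0 T) := by
  obtain ⟨C, hC⟩ := h.exists_bound
  have hyc : ContinuousOn y (Icc 0 T) := h.continuousOn.mono fun _ hs => hs.1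
  have hcomp : IsCompact ((y '' Icc 0 T) ×ˢ Metric.closedBall (0 : Fin m → ℝ) C) :=
    (isCompact_Icc.image_of_continuousOn hyc).prod (isCompact_closedBall _ _)
  obtain ⟨D, hD⟩ := hcomp.exists_bound_of_continuousOn hΦ.continuousOn
  have hsub : volume.restrict (Icc 0 T) ≤ volume.restrict (Ici (0 : ℝ)) :=
    Measure.restrict_mono (fun _ hs => hs.1) le_rfl
  have hmeas : AEStronglyMeasurable (fun s => Φ (y s, u s)) (volume.restrict (Icc 0 T)) :=
    hΦ.comp_aestronglyMeasurable ((hyc.aestronglyMeasurable measurableSet_Icc).prodMk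
      (h.control_memLp.aestronglyMeasurable.mono_measure hsub))
  refine Integrable.of_bound hmeas D ?_
  filter_upwards [ae_restrict_mem measurableSet_Icc, ae_mono hsub hC] with s hs hus
  exact hD _ ⟨⟨s, hs, rfl⟩, by simpa using hus⟩

lemma IsControlled.intervalIntegrable {x : Fin d → ℝ} {u : ℝ → Fin m → ℝ} {y : ℝ → Fin d → ℝ}
    (h : IsControlled f B x u y) {E : Type*} [NormedAddCommGroup E]
    {Φ : (Fin d → ℝ) × (Fin m → ℝ) → E} (hΦ : Continuous Φ) {a b : ℝ} (ha : 0 ≤ a) (hb : 0 ≤ b) :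
    IntervalIntegrable (fun s => Φ (y s, u s)) volume a b := by
  have : ∀ b : ℝ, 0 ≤ b → IntervalIntegrable (fun s => Φ (y s, u s)) volume 0 b := fun b hb =>
    (intervalIntegrable_iff_integrableOn_Icc_of_le hb).2 (h.integrableOn hΦ b)
  exact (this a ha).symm.trans (this b hb)

lemma continuous_dynamics (hf : Continuous f) (hB : Continuous B) :
    Continuous fun p : (Fin d → ℝ) × (Fin m → ℝ) => f p.1 + B p.1 *ᵥ p.2 :=
  (hf.comp continuous_fst).add ((hB.comp continuous_fst).matrix_mulVec continuous_snd)

lemma IsControlled.shift (hf : Continuous f) (hB : Continuous B) {x : Fin d → ℝ}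
    {u : ℝ → Fin m → ℝ} {y : ℝ → Fin d → ℝ} (hc : IsControlled f B x u y) {h : ℝ} (hh : 0 ≤ h) :
    IsControlled f B (y h) (fun t => u (t + h)) (fun t => y (t + h)) := by
  have hpre : (fun t => t + h) ⁻¹' Ici h = Ici (0 : ℝ) := by simp
  refine ⟨?_, ?_, fun t ht => ?_⟩
  · have hmp := (measurePreserving_add_right (volume : Measure ℝ) h).restrict_preimage
      (measurableSet_Ici (a := h))
    rw [hpre] at hmp
    exact (hc.control_memLp.mono_measure
      (Measure.restrict_mono (Ici_subset_Ici.2 hh) le_rfl)).comp_measurePreserving hmp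
  · exact hc.continuousOn.comp (by fun_prop) fun t ht => add_nonneg ht hh
  · have hint := fun {a b : ℝ} (ha : 0 ≤ a) (hb : 0 ≤ b) =>
      hc.intervalIntegrable (continuous_dynamics hf hB) ha hb
    rw [intervalIntegral.integral_comp_add_right (fun s => f (y s) + B (y s) *ᵥ u s) h, zero_add,
      hc.eq_integral _ (add_nonneg ht hh), hc.eq_integral h hh, add_assoc,
      intervalIntegral.integral_add_adjacent_intervals (hint le_rfl hh)
        (hint hh (add_nonneg ht hh))]

/-- One half of the dynamic programming principle. -/
lemma IsControlled.integral_add_value_le (hf : Continuous f) (hB : Continuous B)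
    (hQ : Q.PosSemidef) (hR : R.PosDef) {x : Fin d → ℝ} {u : ℝ → Fin m → ℝ} {y : ℝ → Fin d → ℝ}
    (hc : IsControlled f B x u y) {h : ℝ} (hh : 0 ≤ h) {J : ℝ} (hJ0 : 0 ≤ J)
    (hJ : cost Q R u y ≤ ENNReal.ofReal J) :
    (∫ s in (0 : ℝ)..h, runningCost Q R (y s) (u s)) + value f B Q R (y h) ≤ J := by
  have hpre : (fun t => t + h) ⁻¹' Ici h = Ici (0 : ℝ) := by simp
  have hshift : cost Q R (fun t => u (t + h)) (fun t => y (t + h)) =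
      ∫⁻ s in Ici h, ENNReal.ofReal (runningCost Q R (y s) (u s)) := by
    have := (measurePreserving_add_right (volume : Measure ℝ) h).setLIntegral_comp_preimage_emb
      (measurableEmbedding_addRight h)
      (fun s => ENNReal.ofReal (runningCost Q R (y s) (u s))) (Ici h)
    rw [hpre] at this
    exact this
  have hint : IntervalIntegrable (fun s => runningCost Q R (y s) (u s)) volume 0 h :=
    hc.intervalIntegrable continuous_runningCost le_rfl hh
  have hfirst : ENNReal.ofReal (∫ s in (0 : ℝ)..h, runningCost Q R (y s) (u s)) =
      ∫⁻ s in Ico 0 h, ENNReal.ofReal (runningCost Q R (y s) (u s)) := by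
    rw [intervalIntegral.integral_of_le hh, ofReal_integral_eq_lintegral_ofReal
      ((intervalIntegrable_iff_integrableOn_Ioc_of_le hh).1 hint)
      (ae_of_all _ fun s => runningCost_nonneg hQ hR _ _)]
    exact setLIntegral_congr Ico_ae_eq_Ioc.symm
  have hsplit : cost Q R u y =
      ENNReal.ofReal (∫ s in (0 : ℝ)..h, runningCost Q R (y s) (u s)) +
        cost Q R (fun t => u (t + h)) (fun t => y (t + h)) := by
    rw [hshift, hfirst, cost, ← Ico_union_Ici_eq_Ici hh, lintegral_union measurableSet_Ici]
    exact disjoint_left.2 fun s hs hs' => absurd hs.2 (not_lt.2 hs')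
  have hle : ENNReal.ofReal (∫ s in (0 : ℝ)..h, runningCost Q R (y s) (u s)) +
      valueENN f B Q R (y h) ≤ ENNReal.ofReal J :=
    (add_le_add_right (valueENN_le (hc.shift hf hB hh)) _).trans (hsplit ▸ hJ)
  -- Without finiteness `value` would be the default 0 and would not represent the infimum.
  have hfin : valueENN f B Q R (y h) ≠ ∞ :=
    ne_top_of_le_ne_top ENNReal.ofReal_ne_top (le_add_self.trans hle)
  have hi0 : 0 ≤ ∫ s in (0 : ℝ)..h, runningCost Q R (y s) (u s) :=
    intervalIntegral.integral_nonneg hh fun s _ => runningCost_nonneg hQ hR _ _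
  rw [← ENNReal.ofReal_toReal hfin, ← ENNReal.ofReal_add hi0 ENNReal.toReal_nonneg,
    ENNReal.ofReal_le_ofReal_iff hJ0] at hle
  exact hle

lemma exists_local_bound (hf : Continuous f) (hB : Continuous B) (x : Fin d → ℝ) :
    ∃ M > 0, ∀ᶠ z in 𝓝 x, ∀ u : Fin m → ℝ, ‖f z + B z *ᵥ u‖ ≤ M * (1 + ‖u‖) := by
  have hB' : Continuous fun z => entrySum (B z) := continuous_entrySum.comp hB
  refine ⟨max (‖f x‖ + 1) (entrySum (B x) + 1), by positivity, ?_⟩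
  filter_upwards [hf.norm.continuousAt.eventually_lt_const (lt_add_one ‖f x‖),
    hB'.continuousAt.eventually_lt_const (lt_add_one (entrySum (B x)))] with z h1 h2 u
  calc ‖f z + B z *ᵥ u‖ ≤ ‖f z‖ + entrySum (B z) * ‖u‖ :=
        (norm_add_le _ _).trans (add_le_add_right (norm_mulVec_le _ _) _)
    _ ≤ max (‖f x‖ + 1) (entrySum (B x) + 1) + max (‖f x‖ + 1) (entrySum (B x) + 1) * ‖u‖ := by
        gcongr
        · exact h1.le.trans (le_max_left _ _)
        · exact h2.le.trans (le_max_right _ _)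
    _ = _ := by ring

/-- If the Hamiltonian of the costate `q` is positive at `x`, it stays positive near `x`, uniformly
in the control, even after subtracting a small multiple of the speed. -/
lemma hamiltonian_lower_bound (hf : Continuous f) (hB : Continuous B) (hR : R.PosDef)
    {x q : Fin d → ℝ} {e : ℝ} (he : 0 < e)
    (hH : e ≤ q ⬝ᵥ f x - (1 / 4 : ℝ) * (q ⬝ᵥ (B x * R⁻¹ * (B x)ᵀ) *ᵥ q) + x ⬝ᵥ Q *ᵥ x) :
    ∃ ε > 0, ∀ᶠ z in 𝓝 x, ∀ u : Fin m → ℝ, e / 2 ≤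
      q ⬝ᵥ (f z + B z *ᵥ u) + runningCost Q R z u - ε * ‖f z + B z *ᵥ u‖ := by
  obtain ⟨r, hr, hRr⟩ := exists_pos_le_of_posDef hR
  obtain ⟨M, hM, hMz⟩ := exists_local_bound hf hB x
  have hcH : Continuous fun z => q ⬝ᵥ f z - (1 / 4 : ℝ) * (q ⬝ᵥ (B z * R⁻¹ * (B z)ᵀ) *ᵥ q) +
      z ⬝ᵥ Q *ᵥ z := by
    have h1 : Continuous fun z => B z * R⁻¹ * (B z)ᵀ := by fun_prop
    exact ((continuous_const.dotProduct hf).sub (continuous_const.mul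
      (continuous_const.dotProduct (h1.matrix_mulVec continuous_const)))).add
      (continuous_id.dotProduct (continuous_const.matrix_mulVec continuous_id))
  have hck : Continuous fun z => ‖minControl (B z) R q‖ := by
    unfold minControl
    exact ((continuous_const.matrix_mulVec
      (hB.matrix_transpose.matrix_mulVec continuous_const)).const_smul (1 / 2 : ℝ)).neg.norm
  set k₀ := ‖minControl (B x) R q‖ + 1 with hk₀
  have hk₀' : 0 ≤ k₀ := by positivity
  -- The first bound lets the R-square absorb the part of the speed quadratic in u - k; the second
  -- keeps the rest below e/4, out of the available 3e/4.
  set ε := min (r / M) (e / (4 * M * (2 + k₀))) with hε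
  have hε0 : 0 < ε := by positivity
  refine ⟨ε, hε0, ?_⟩
  filter_upwards [hMz, hcH.continuousAt.eventually_const_lt (u := 3 / 4 * e) (by linarith),
    hck.continuousAt.eventually_lt_const (lt_add_one _)] with z h1 h2 h3 u
  rw [completing_square (B z) hR]
  set k := minControl (B z) R q
  have h4 := hRr (u - k)
  have h5 : ‖u‖ ≤ k₀ + 1 + ‖u - k‖ ^ 2 := by
    have h6 : ‖u‖ ≤ ‖k‖ + ‖u - k‖ := by
      calc ‖u‖ = ‖k + (u - k)‖ := by rw [add_sub_cancel]
        _ ≤ _ := norm_add_le _ _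
    nlinarith [sq_nonneg (‖u - k‖ - 1), norm_nonneg (u - k)]
  have h7 : ε * M ≤ r := by
    rw [← le_div_iff₀ hM]; exact min_le_left _ _
  have h8 : ε * M * (2 + k₀) ≤ e / 4 := by
    have := min_le_right (r / M) (e / (4 * M * (2 + k₀)))
    rw [← hε, le_div_iff₀ (by positivity)] at this
    linarith
  have h9 : ε * ‖f z + B z *ᵥ u‖ ≤ e / 4 + r * ‖u - k‖ ^ 2 := by
    calc ε * ‖f z + B z *ᵥ u‖ ≤ ε * (M * (1 + (k₀ + 1 + ‖u - k‖ ^ 2))) := by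
          gcongr
          exact (h1 u).trans (by gcongr)
      _ = ε * M * (2 + k₀) + ε * M * ‖u - k‖ ^ 2 := by ring
      _ ≤ _ := by gcongr
  linarith

/-- Trajectories of bounded cost stay close to the initial state for a short time. -/
lemma exists_short_time (hf : Continuous f) (hB : Continuous B) (hQ : Q.PosSemidef) (hR : R.PosDef)
    (x : Fin d → ℝ) {J δ : ℝ} (hJ : 0 ≤ J) (hδ : 0 < δ) :
    ∃ h₀ > 0, ∀ h, 0 ≤ h → h < h₀ → ∀ u y, IsControlled f B x u y →
      (∫ s in (0 : ℝ)..h, runningCost Q R (y s) (u s)) ≤ J → ∀ t ∈ Icc 0 h, ‖y t - x‖ < δ := by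
  obtain ⟨r, hr, hRr⟩ := exists_pos_le_of_posDef hR
  obtain ⟨M, hM, hMz⟩ := exists_local_bound hf hB x
  obtain ⟨δ', hδ', hball⟩ := Metric.eventually_nhds_iff.1 hMz
  set ρ := min δ (δ' / 2) with hρdef
  have hρ : 0 < ρ := by positivity
  -- Controls have no common sup bound, so the speed is bounded through ‖u‖ ≤ 1/(4η) + η‖u‖²: the
  -- cost bound makes the second part contribute at most ρ/2, and short time handles the first.
  set η := ρ * r / (2 * M * (J + 1)) with hη
  have hη0 : 0 < η := by positivity
  set a := M * (1 + 1 / (4 * η)) with ha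
  have ha0 : 0 < a := by positivity
  refine ⟨ρ / (2 * a), by positivity, fun h hh hlt u y hc hcost => ?_⟩
  have hy0 : y 0 = x := by simpa using hc.eq_integral 0 le_rfl
  suffices hs : ∀ t ∈ Icc 0 h, ‖y t - x‖ < ρ from fun t ht => (hs t ht).trans_le (min_le_left _ _)
  refine forall_lt_of_first_exit (φ := fun t => ‖y t - x‖)
    (((hc.continuousOn.mono fun _ hs => hs.1).sub continuousOn_const).norm) (by simp [hy0, hρ])
    fun t ht hs => ?_
  have hint := fun {Φ : (Fin d → ℝ) × (Fin m → ℝ) → ℝ} (hΦ : Continuous Φ) =>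
    hc.intervalIntegrable hΦ le_rfl ht.1
  have hpt : ∀ s ∈ Icc 0 t, ‖f (y s) + B (y s) *ᵥ u s‖ ≤
      a + M * η / r * runningCost Q R (y s) (u s) := by
    intro s hst
    have hd : dist (y s) x < δ' := by
      rw [dist_eq_norm]
      refine (hs s hst).trans_lt ?_
      linarith [min_le_right δ (δ' / 2)]
    have h1 := hball hd (u s)
    have h2 : ‖u s‖ ≤ 1 / (4 * η) + η * ‖u s‖ ^ 2 := by
      have h3 : 1 / (4 * η) + η * ‖u s‖ ^ 2 - ‖u s‖ = (2 * η * ‖u s‖ - 1) ^ 2 / (4 * η) := by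
        field_simp; ring
      have h4 : 0 ≤ (2 * η * ‖u s‖ - 1) ^ 2 / (4 * η) := by positivity
      linarith
    have h3 : r * ‖u s‖ ^ 2 ≤ runningCost Q R (y s) (u s) :=
      (hRr (u s)).trans (le_add_of_nonneg_left (posSemidef_nonneg hQ _))
    calc _ ≤ M * (1 + (1 / (4 * η) + η * ‖u s‖ ^ 2)) := h1.trans (by gcongr)
      _ = a + M * η / r * (r * ‖u s‖ ^ 2) := by rw [ha]; field_simp; ring
      _ ≤ _ := by gcongr
  have hcost' : (∫ s in (0 : ℝ)..t, runningCost Q R (y s) (u s)) ≤ J := by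
    refine le_trans ?_ hcost
    exact intervalIntegral.integral_mono_interval le_rfl ht.1 ht.2
      (ae_of_all _ fun s => runningCost_nonneg hQ hR _ _)
      (hc.intervalIntegrable continuous_runningCost le_rfl hh)
  have hMη : M * η / r * (J + 1) = ρ / 2 := by rw [hη]; field_simp
  have hah : a * t < ρ / 2 := by
    have := ht.2.trans_lt hlt
    rw [lt_div_iff₀ (by positivity)] at this
    linarith
  calc ‖y t - x‖ = ‖∫ s in (0 : ℝ)..t, (f (y s) + B (y s) *ᵥ u s)‖ := by
        rw [hc.eq_integral t ht.1, add_sub_cancel_left]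
    _ ≤ ∫ s in (0 : ℝ)..t, ‖f (y s) + B (y s) *ᵥ u s‖ :=
        intervalIntegral.norm_integral_le_integral_norm ht.1
    _ ≤ ∫ s in (0 : ℝ)..t, (a + M * η / r * runningCost Q R (y s) (u s)) :=
        intervalIntegral.integral_mono_on ht.1 (hint (continuous_dynamics hf hB).norm)
          (hint (continuous_const.add (continuous_const.mul continuous_runningCost))) hpt
    _ = a * t + M * η / r * ∫ s in (0 : ℝ)..t, runningCost Q R (y s) (u s) := by
        rw [intervalIntegral.integral_add (by simp)
          ((hint continuous_runningCost).const_mul _), intervalIntegral.integral_const,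
          intervalIntegral.integral_const_mul, smul_eq_mul, sub_zero, mul_comm t]
    _ ≤ a * t + M * η / r * (J + 1) := by gcongr; linarith
    _ < ρ := by linarith

/-- At a point of differentiability the value function is a supersolution of the
Hamilton-Jacobi-Bellman equation. -/
lemma hjbResidual_value_nonpos (hf : Continuous f) (hB : Continuous B) (hQ : Q.PosSemidef)
    (hR : R.PosDef) {x : Fin d → ℝ} (hfin : valueENN f B Q R x ≠ ∞)
    (hdiff : DifferentiableAt ℝ (value f B Q R) x) :
    hjbResidual f B Q R (value f B Q R) x ≤ 0 := by
  by_contra! he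
  set V := value f B Q R with hV
  set e := hjbResidual f B Q R V x with hedef
  set q := grad V x with hq
  -- The reserve ε times the speed will absorb the Taylor remainder ε‖y(h) - x‖, since y(h) - x need
  -- not be O(h) uniformly over controls.
  obtain ⟨ε, hε, hlow⟩ := hamiltonian_lower_bound (q := q) (Q := Q) hf hB hR he le_rfl
  have htay := hdiff.hasFDerivAt.isLittleO.def hε
  obtain ⟨δ, hδ, hball⟩ := Metric.eventually_nhds_iff.1 (hlow.and htay)
  have hVx : 0 ≤ V x := value_nonneg x
  obtain ⟨h₀, hh₀, hshort⟩ := exists_short_time hf hB hQ hR x (J := V x + 1) (by linarith) hδ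
  -- For an h²-optimal control the dynamic programming inequality gives an upper bound h² ≤ he/4 for
  -- the integral that `hmain` bounds below by he/2.
  set h := min (h₀ / 2) (min (e / 4) 1) with hh
  have hh0 : 0 < h := by positivity
  have hhh₀ : h < h₀ := (min_le_left _ _).trans_lt (by linarith)
  have hhe : h ≤ e / 4 := (min_le_right _ _).trans (min_le_left _ _)
  have hh1 : h ≤ 1 := (min_le_right _ _).trans (min_le_right _ _)
  have hlt : valueENN f B Q R x < ENNReal.ofReal (V x + h ^ 2) := by
    rw [← ENNReal.ofReal_toReal hfin]
    exact (ENNReal.ofReal_lt_ofReal_iff (by positivity)).2 (by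
      change V x < V x + h ^ 2
      have : 0 < h ^ 2 := by positivity
      linarith)
  simp only [valueENN, iInf_lt_iff] at hlt
  obtain ⟨u, y, hc, hcost⟩ := hlt
  have hdpp := hc.integral_add_value_le hf hB hQ hR hh0.le (by positivity) hcost.le
  have hJ : (∫ s in (0 : ℝ)..h, runningCost Q R (y s) (u s)) ≤ V x + 1 := by
    have h1 : 0 ≤ value f B Q R (y h) := value_nonneg _
    have h2 : h ^ 2 ≤ 1 := by nlinarith
    linarith
  have hclose : ∀ t ∈ Icc 0 h, dist (y t) x < δ := fun t ht => by
    rw [dist_eq_norm]; exact hshort h hh0.le hhh₀ u y hc hJ t ht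
  have hint := fun {E : Type} [NormedAddCommGroup E]
    {Φ : (Fin d → ℝ) × (Fin m → ℝ) → E} (hΦ : Continuous Φ) =>
    hc.intervalIntegrable hΦ le_rfl hh0.le
  have hF := continuous_dynamics hf hB
  have hqF : Continuous fun p : (Fin d → ℝ) × (Fin m → ℝ) =>
      fderiv ℝ V x (f p.1 + B p.1 *ᵥ p.2) := (fderiv ℝ V x).continuous.comp hF
  have hyh : y h - x = ∫ s in (0 : ℝ)..h, (f (y s) + B (y s) *ᵥ u s) := by
    rw [hc.eq_integral h hh0.le, add_sub_cancel_left]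
  have hlin : fderiv ℝ V x (y h - x) =
      ∫ s in (0 : ℝ)..h, fderiv ℝ V x (f (y s) + B (y s) *ᵥ u s) := by
    rw [hyh, ContinuousLinearMap.intervalIntegral_comp_comm _ (hint hF)]
  have hnorm : ‖y h - x‖ ≤ ∫ s in (0 : ℝ)..h, ‖f (y s) + B (y s) *ᵥ u s‖ := by
    rw [hyh]
    exact intervalIntegral.norm_integral_le_integral_norm hh0.le
  have hmain : h * (e / 2) ≤ ∫ s in (0 : ℝ)..h, (fderiv ℝ V x (f (y s) + B (y s) *ᵥ u s) +
      runningCost Q R (y s) (u s) - ε * ‖f (y s) + B (y s) *ᵥ u s‖) := by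
    have h1 : ∫ _s in (0 : ℝ)..h, e / 2 = h * (e / 2) := by
      rw [intervalIntegral.integral_const, smul_eq_mul, sub_zero]
    rw [← h1]
    refine intervalIntegral.integral_mono_on hh0.le (by simp)
      (hint ((hqF.add continuous_runningCost).sub (continuous_const.mul hF.norm))) fun s hs => ?_
    have h2 := (hball (hclose s hs)).1 (u s)
    rwa [hq, grad_dotProduct] at h2
  rw [intervalIntegral.integral_sub ((hint hqF).add (hint continuous_runningCost))
    ((hint hF.norm).const_mul ε), intervalIntegral.integral_add (hint hqF)
    (hint continuous_runningCost), intervalIntegral.integral_const_mul, ← hlin] at hmain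
  have hend := (hball (hclose h ⟨hh0.le, le_rfl⟩)).2
  have hend' := (abs_le.1 hend).1
  have h3 := mul_le_mul_of_nonneg_left hnorm hε.le
  have h4 : value f B Q R (y h) = V (y h) := rfl
  nlinarith

end HJB

/-! ### Finiteness of V, the two-sided error bound, and exponential decay -/

section Main

variable {d m : ℕ} {f : (Fin d → ℝ) → Fin d → ℝ} {B : (Fin d → ℝ) → Matrix (Fin d) (Fin m) ℝ}
  {Q : Matrix (Fin d) (Fin d) ℝ} {R : Matrix (Fin m) (Fin m) ℝ}
  {A P : (Fin d → ℝ) → Matrix (Fin d) (Fin d) ℝ}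

/-- The feedback generated by `V_S` agrees to first order with the linear feedback. -/
lemma linear_feedback_sub_le {O : Set (Fin d → ℝ)} (hO : O ∈ 𝓝 0) (hB : ContinuousAt B 0)
    (hPT : ∀ x ∈ O, (P x)ᵀ = P x) (hP : ∀ i j, ContDiffAt ℝ 1 (fun x => P x i j) 0)
    {δ : ℝ} (hδ : 0 < δ) :
    ∀ᶠ z in 𝓝 (0 : Fin d → ℝ),
      ‖-((R⁻¹ * (B 0)ᵀ * P 0) *ᵥ z) - feedback B R (valueS P) z‖ ≤ δ * ‖z‖ := by
  obtain ⟨K, hK0, hK⟩ := norm_grad_valueS_sub_le hO hPT hP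
  have hPc : ContinuousAt P 0 :=
    continuousAt_pi.2 fun i => continuousAt_pi.2 fun j => (hP i j).continuousAt
  have hRBc : ContinuousAt (fun z => R⁻¹ * (B z)ᵀ) 0 := by
    have : Continuous fun M : Matrix (Fin d) (Fin m) ℝ => R⁻¹ * Mᵀ := by fun_prop
    exact this.continuousAt.comp hB
  have hMc : ContinuousAt (fun z => R⁻¹ * (B z)ᵀ * P z) 0 := by
    have : Continuous fun M : Matrix (Fin m) (Fin d) ℝ × Matrix (Fin d) (Fin d) ℝ => M.1 * M.2 := by
      fun_prop
    exact this.continuousAt.comp (hRBc.prodMk hPc)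
  set β := entrySum (R⁻¹ * (B 0)ᵀ) + 1
  have hβ : 0 < β := by have := entrySum_nonneg (R⁻¹ * (B 0)ᵀ); positivity
  have hsmall : ∀ᶠ z in 𝓝 (0 : Fin d → ℝ), β * K * ‖z‖ < δ / 2 := by
    have : ContinuousAt (fun z : Fin d → ℝ => β * K * ‖z‖) 0 := by fun_prop
    exact this.eventually_lt_const (by simpa using hδ)
  filter_upwards [hO, hK, eventually_entrySum_lt hRBc, eventually_entrySum_sub_lt hMc (half_pos hδ),
    hsmall] with z hzO hr hRBz hMz hz
  set r := grad (valueS P) z - (2 : ℝ) • (P z *ᵥ z) with hrdef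
  have hgrad : grad (valueS P) z = (2 : ℝ) • (P z *ᵥ z) + r := by rw [hrdef]; abel
  have heq : -((R⁻¹ * (B 0)ᵀ * P 0) *ᵥ z) - feedback B R (valueS P) z =
      (R⁻¹ * (B z)ᵀ * P z - R⁻¹ * (B 0)ᵀ * P 0) *ᵥ z +
        (1 / 2 : ℝ) • ((R⁻¹ * (B z)ᵀ) *ᵥ r) := by
    rw [feedback, hgrad]
    simp only [Matrix.mulVec_add, Matrix.mulVec_smul, Matrix.sub_mulVec, smul_add, smul_smul,
      ← Matrix.mulVec_mulVec]
    norm_num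
    abel
  rw [heq]
  calc _ ≤ δ / 2 * ‖z‖ + 1 / 2 * (β * (K * ‖z‖ ^ 2)) := by
        refine (norm_add_le _ _).trans (add_le_add ?_ ?_)
        · exact (norm_mulVec_le _ _).trans (by gcongr)
        · rw [norm_smul, Real.norm_of_nonneg (by norm_num)]
          gcongr
          exact (norm_mulVec_le _ _).trans (by gcongr)
    _ = δ / 2 * ‖z‖ + 1 / 2 * (β * K * ‖z‖ * ‖z‖) := by ring
    _ ≤ δ / 2 * ‖z‖ + 1 / 2 * (δ / 2 * ‖z‖) := by gcongr
    _ ≤ _ := by nlinarith [norm_nonneg z]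

lemma eventually_valueS {O : Set (Fin d → ℝ)} (hO : O ∈ 𝓝 0) (hPpsd : ∀ x ∈ O, (P x).PosSemidef)
    (hP : ∀ i j, ContDiffAt ℝ 1 (fun x => P x i j) 0) :
    ∃ C, ∀ᶠ z in 𝓝 (0 : Fin d → ℝ), DifferentiableAt ℝ (valueS P) z ∧ 0 ≤ valueS P z ∧
      valueS P z ≤ C * ‖z‖ ^ 2 := by
  have hPc : ContinuousAt P 0 :=
    continuousAt_pi.2 fun i => continuousAt_pi.2 fun j => (hP i j).continuousAt
  have hdiff : ∀ i j, ∀ᶠ z in 𝓝 (0 : Fin d → ℝ), DifferentiableAt ℝ (fun x => P x i j) z :=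
    fun i j => ((hP i j).eventually (by simp)).mono fun z hz => hz.differentiableAt one_ne_zero
  refine ⟨d * (entrySum (P 0) + 1), ?_⟩
  filter_upwards [hO, eventually_all.2 fun i => eventually_all.2 (hdiff i), abs_valueS_le hPc]
    with z h1 h2 h3
  exact ⟨differentiableAt_valueS h2, posSemidef_nonneg (hPpsd z h1) z, (le_abs_self _).trans h3⟩

/-- The linear feedback of the Riccati equation at the origin shows that the value function is
finite, and of quadratic growth, near the origin. -/
lemma exists_valueENN_le {O : Set (Fin d → ℝ)} (hO : O ∈ 𝓝 0) (hQ : Q.PosSemidef) (hR : R.PosDef)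
    (hf : ContDiff ℝ 1 f) (hB : ∀ i j, ContDiff ℝ 1 (fun x => B x i j))
    (hA : ContinuousAt A 0) (hfA : ∀ x ∈ O, f x = A x *ᵥ x)
    (hdet : Detectable (A 0) (CFC.sqrt Q))
    (hPpsd : ∀ x ∈ O, (P x).PosSemidef) (hPric : ∀ x ∈ O, SolvesRiccati (A x) (B x) Q R (P x))
    (hP : ∀ i j, ContDiffAt ℝ 1 (fun x => P x i j) 0) :
    ∃ C, ∀ᶠ x in 𝓝 (0 : Fin d → ℝ), valueENN f B Q R x ≤ ENNReal.ofReal (C * ‖x‖ ^ 2) := by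
  have hBc : Continuous B := continuous_pi fun i => continuous_pi fun j => (hB i j).continuous
  have hPT : ∀ x ∈ O, (P x)ᵀ = P x := fun x hx =>
    transpose_eq_of_isHermitian (hPpsd x hx).isHermitian
  obtain ⟨ε, hε, htrap⟩ := exists_trapping hQ hR hA hBc.continuousAt
    (eventually_of_mem hO hfA) hdet
  set M := R⁻¹ * (B 0)ᵀ * P 0 with hM
  -- The linear feedback makes the closed loop C¹, hence locally Lipschitz, so solutions exist; ũ_S
  -- is only known to be continuous.
  set k : (Fin d → ℝ) → Fin m → ℝ := fun z => -(M *ᵥ z) with hk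
  obtain ⟨Cv, hU⟩ := eventually_valueS hO hPpsd hP
  set ρR : ℝ := m * entrySum R with hρR
  have hρR0 : 0 ≤ ρR := by have := entrySum_nonneg R; positivity
  -- The square of the deviation from ũ_S then costs at most (ε/2)‖z‖²; the residual takes the other
  -- half of ε.
  set δ := min 1 (ε / (2 * (ρR + 1))) with hδ
  have hδ0 : 0 < δ := by positivity
  have hδε : ρR * δ ^ 2 ≤ ε / 2 := by
    have h1 : δ ^ 2 ≤ δ := by
      have : δ ≤ 1 := min_le_left _ _
      nlinarith
    have h2 : δ ≤ ε / (2 * (ρR + 1)) := min_le_right _ _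
    rw [le_div_iff₀ (by positivity)] at h2
    nlinarith
  have hdec : ∀ᶠ z in 𝓝 (0 : Fin d → ℝ), fderiv ℝ (valueS P) z (f z + B z *ᵥ k z) ≤
      -runningCost Q R z (k z) + ε * ‖z‖ ^ 2 := by
    filter_upwards [hjbResidual_valueS_le hO hR hA hBc.continuousAt hfA hPT hPric hP (half_pos hε),
      linear_feedback_sub_le (R := R) hO hBc.continuousAt hPT hP hδ0] with z h1 h2
    rw [fderiv_controlled (Q := Q) hR]
    set w := k z - feedback B R (valueS P) z with hw
    have h3 : w ⬝ᵥ R *ᵥ w ≤ ε / 2 * ‖z‖ ^ 2 := by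
      calc w ⬝ᵥ R *ᵥ w ≤ ρR * ‖w‖ * ‖w‖ := (le_abs_self _).trans (abs_dotProduct_mulVec_le R w w)
        _ ≤ ρR * (δ * ‖z‖) * (δ * ‖z‖) := by gcongr
        _ = ρR * δ ^ 2 * ‖z‖ ^ 2 := by ring
        _ ≤ _ := by gcongr
    have h4 := (le_abs_self _).trans h1
    linarith
  have hF : ContDiff ℝ 1 fun z => f z + B z *ᵥ k z := by
    refine hf.add (contDiff_pi.2 fun i => ?_)
    simp only [hk, Matrix.mulVec, dotProduct, Pi.neg_apply]
    exact ContDiff.sum fun j _ => (hB i j).mul (ContDiff.neg (ContDiff.sum fun l _ =>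
      contDiff_const.mul (contDiff_apply ℝ ℝ l)))
  obtain ⟨K, t, ht, hlip⟩ := (hF.contDiffAt (x := 0)).exists_lipschitzOnWith
  obtain ⟨ρ, hρ, hall⟩ := eventually_nhds_zero_iff.1 ((hU.and hdec).and ht)
  obtain ⟨C', hC'⟩ := htrap _ k Cv hU hdec ρ hρ
  refine ⟨Cv + ε * C', ?_⟩
  filter_upwards [hC', hU] with x hx hUx
  obtain ⟨y, hy0, y', hy, hy'⟩ := exists_solution_of_lipschitzOnWith hρ.le
    (hlip.mono fun z hz => (hall z (by simpa using hz)).2) x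
  have htr := hx y y' hy0 hy (fun t _ => hy' t)
  -- The trapped solution never meets the truncation, so it solves the original equation.
  have hyd : ∀ t, 0 ≤ t → HasDerivWithinAt y (f (y t) + B (y t) *ᵥ k (y t)) (Ici 0) t :=
    fun t ht => hy' t (htr t ht).1.le ▸ hy t ht
  have hyc : ContinuousOn y (Ici 0) := fun t ht => (hy t ht).continuousWithinAt
  have hkc : ContinuousOn (fun t => k (y t)) (Ici 0) :=
    (continuousOn_mulVec continuousOn_const hyc).neg
  refine valueENN_le_ofReal hf.continuous hBc hQ hR hy0 hyd hkc (C := entrySum M * ρ)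
    (fun t ht => ?_) fun T hT => ?_
  · rw [hk, norm_neg]
    refine (norm_mulVec_le _ _).trans ?_
    have := (htr t ht).1.le
    have := entrySum_nonneg M
    gcongr
  · have hℓ : ContinuousOn (fun t => runningCost Q R (y t) (k (y t))) (Ici 0) :=
      continuousOn_runningCost hyc hkc
    have hsq : ContinuousOn (fun t => ε * ‖y t‖ ^ 2) (Ici 0) := by fun_prop
    have h1 := sub_le_integral_of_hasDerivWithinAt_Ici hT (g := fun t => valueS P (y t))
      (φ := fun t => -runningCost Q R (y t) (k (y t)) + ε * ‖y t‖ ^ 2)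
      (fun t ht => (hall (y t) (htr t ht.1).1.le).1.1.1.hasFDerivAt.comp_hasDerivWithinAt t
        (hyd t ht.1)) (by fun_prop) fun t ht => (hall (y t) (htr t ht.1).1.le).1.2
    rw [intervalIntegral.integral_add
      (intervalIntegrable_of_continuousOn_Ici hℓ.fun_neg hT)
      (intervalIntegrable_of_continuousOn_Ici hsq hT), intervalIntegral.integral_neg,
      intervalIntegral.integral_const_mul, hy0] at h1
    have h2 := (hall (y T) (htr T hT).1.le).1.1.2.1
    have h3 := mul_le_mul_of_nonneg_left (htr T hT).2 hε.le
    have h4 := hUx.2.2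
    linarith

lemma contDiffOn_valueS {O : Set (Fin d → ℝ)} (hP : ∀ i j, ContDiffOn ℝ 1 (fun x => P x i j) O) :
    ContDiffOn ℝ 1 (valueS P) O := by
  unfold valueS dotProduct Matrix.mulVec dotProduct
  exact ContDiffOn.sum fun i _ => (contDiff_apply ℝ ℝ i).contDiffOn.mul
    (ContDiffOn.sum fun j _ => (hP i j).mul (contDiff_apply ℝ ℝ j).contDiffOn)

lemma continuousOn_grad {O : Set (Fin d → ℝ)} (hO : IsOpen O) {W : (Fin d → ℝ) → ℝ}
    (hW : ContDiffOn ℝ 1 W O) : ContinuousOn (grad W) O :=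
  continuousOn_pi.2 fun _ => (hW.continuousOn_fderiv_of_isOpen hO le_rfl).clm_apply
    continuousOn_const

lemma continuousOn_feedback {O : Set (Fin d → ℝ)} (hO : IsOpen O) (hB : Continuous B)
    {W : (Fin d → ℝ) → ℝ} (hW : ContDiffOn ℝ 1 W O) : ContinuousOn (feedback B R W) O := by
  refine ContinuousOn.neg (ContinuousOn.const_smul ?_ (1 / 2 : ℝ))
  exact continuousOn_mulVec continuousOn_const
    (continuousOn_mulVec hB.matrix_transpose.continuousOn (continuousOn_grad hO hW))

lemma continuousOn_hjbResidual {O : Set (Fin d → ℝ)} (hO : IsOpen O) (hf : Continuous f)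
    (hB : Continuous B) {W : (Fin d → ℝ) → ℝ} (hW : ContDiffOn ℝ 1 W O) :
    ContinuousOn (hjbResidual f B Q R W) O := by
  have hg := continuousOn_grad hO hW
  have h1 : Continuous fun z => B z * R⁻¹ * (B z)ᵀ := by fun_prop
  exact ((continuousOn_dotProduct hg hf.continuousOn).sub (continuousOn_const.mul
    (continuousOn_dotProduct hg (continuousOn_mulVec h1.continuousOn hg)))).add
    (continuousOn_dotProduct continuousOn_id (continuousOn_mulVec continuousOn_const
      continuousOn_id))

lemma intervalIntegral_le_integral_Ioi_abs {h : ℝ → ℝ} (hh : IntegrableOn h (Ioi 0)) {T : ℝ}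
    (hT : 0 ≤ T) : ∫ t in (0 : ℝ)..T, |h t| ≤ ∫ t in Ioi (0 : ℝ), |h t| := by
  rw [intervalIntegral.integral_of_le hT]
  exact setIntegral_mono_set hh.abs (ae_of_all _ fun _ => abs_nonneg _)
    Ioc_subset_Ioi_self.eventuallyLE

/-- Residual error bound for the value functions along both closed-loop systems. -/
lemma eventually_error_bound (hf : ContDiff ℝ 1 f) (hB : ∀ i j, ContDiff ℝ 1 (fun x => B x i j))
    (hQ : Q.PosSemidef) (hR : R.PosDef) {O : Set (Fin d → ℝ)} (hO : IsOpen O) (h0 : 0 ∈ O)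
    (hA : ContinuousOn A O) (hfA : ∀ x ∈ O, f x = A x *ᵥ x)
    (hdet : Detectable (A 0) (CFC.sqrt Q))
    (hPpsd : ∀ x ∈ O, (P x).PosSemidef) (hPric : ∀ x ∈ O, SolvesRiccati (A x) (B x) Q R (P x))
    (hP : ∀ i j, ContDiffOn ℝ 1 (fun x => P x i j) O)
    (hV : ∀ᶠ x in 𝓝 (0 : Fin d → ℝ), DifferentiableAt ℝ (value f B Q R) x) :
    ∀ᶠ x in 𝓝 (0 : Fin d → ℝ), valueENN f B Q R x ≠ ∞ ∧
      ∀ yStar yTilde : ℝ → Fin d → ℝ,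
        IsSolution (closedLoop f B R (value f B Q R)) x yStar →
        IsSolution (closedLoop f B R (valueS P)) x yTilde →
        IntegrableOn (fun t => hjbResidual f B Q R (valueS P) (yStar t)) (Ioi 0) ∧
        IntegrableOn (fun t => hjbResidual f B Q R (valueS P) (yTilde t)) (Ioi 0) ∧
        |valueS P x - value f B Q R x| ≤
          max (∫ t in Ioi (0 : ℝ), |hjbResidual f B Q R (valueS P) (yStar t)|)
            (∫ t in Ioi (0 : ℝ), |hjbResidual f B Q R (valueS P) (yTilde t)|) := by
  have hO' : O ∈ 𝓝 (0 : Fin d → ℝ) := hO.mem_nhds h0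
  have hBc : Continuous B := continuous_pi fun i => continuous_pi fun j => (hB i j).continuous
  have hPT : ∀ x ∈ O, (P x)ᵀ = P x := fun x hx =>
    transpose_eq_of_isHermitian (hPpsd x hx).isHermitian
  have hA0 : ContinuousAt A 0 := hA.continuousAt hO'
  have hP0 : ∀ i j, ContDiffAt ℝ 1 (fun x => P x i j) 0 := fun i j => (hP i j).contDiffAt hO'
  obtain ⟨C₀, hC₀⟩ := exists_valueENN_le hO' hQ hR hf hB hA0 hfA hdet hPpsd hPric hP0
  obtain ⟨Cv, hU⟩ := eventually_valueS hO' hPpsd hP0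
  obtain ⟨ε, hε, htrap⟩ := exists_trapping hQ hR hA0 hBc.continuousAt
    (eventually_of_mem hO' hfA) hdet
  set V := value f B Q R with hVdef
  set E := hjbResidual f B Q R (valueS P) with hE
  have hfin : ∀ᶠ x in 𝓝 (0 : Fin d → ℝ), valueENN f B Q R x ≠ ∞ :=
    hC₀.mono fun x hx => ne_top_of_le_ne_top ENNReal.ofReal_ne_top hx
  have hEV : ∀ᶠ x in 𝓝 (0 : Fin d → ℝ), hjbResidual f B Q R V x ≤ 0 := by
    filter_upwards [hfin, hV] with x h1 h2
    exact hjbResidual_value_nonpos hf.continuous hBc hQ hR h1 h2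
  have hUV : ∀ᶠ x in 𝓝 (0 : Fin d → ℝ), DifferentiableAt ℝ V x ∧ 0 ≤ V x ∧
      V x ≤ |C₀| * ‖x‖ ^ 2 := by
    filter_upwards [hC₀, hV] with x h1 h2
    refine ⟨h2, value_nonneg x, ENNReal.toReal_le_of_le_ofReal (by positivity) (h1.trans ?_)⟩
    gcongr
    exact le_abs_self _
  have hEsmall := hjbResidual_valueS_le hO' hR hA0 hBc.continuousAt hfA hPT hPric hP0 hε
  have hdecS : ∀ᶠ z in 𝓝 (0 : Fin d → ℝ),
      fderiv ℝ (valueS P) z (f z + B z *ᵥ feedback B R (valueS P) z) ≤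
      -runningCost Q R z (feedback B R (valueS P) z) + ε * ‖z‖ ^ 2 := by
    filter_upwards [hEsmall] with z h1
    rw [fderiv_closedLoop (Q := Q) hR]
    linarith [(le_abs_self _).trans h1]
  have hdecV : ∀ᶠ z in 𝓝 (0 : Fin d → ℝ), fderiv ℝ V z (f z + B z *ᵥ feedback B R V z) ≤
      -runningCost Q R z (feedback B R V z) + ε * ‖z‖ ^ 2 := by
    filter_upwards [hEV] with z h1
    rw [fderiv_closedLoop (Q := Q) hR]
    have : 0 ≤ ε * ‖z‖ ^ 2 := by positivity
    linarith
  obtain ⟨ρ, hρ, hall⟩ := eventually_nhds_zero_iff.1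
    (((hU.and hUV).and (hEV.and hEsmall)).and hO')
  obtain ⟨CS, hCS⟩ := htrap _ _ Cv hU hdecS ρ hρ
  obtain ⟨CV, hCV⟩ := htrap _ _ _ hUV hdecV ρ hρ
  have hEc : ContinuousOn E O :=
    continuousOn_hjbResidual hO hf.continuous hBc (contDiffOn_valueS hP)
  have hEint : ∀ (y : ℝ → Fin d → ℝ) (M : ℝ), ContinuousOn y (Ici 0) →
      (∀ t, 0 ≤ t → ‖y t‖ < ρ ∧ ∫ s in (0 : ℝ)..t, ‖y s‖ ^ 2 ≤ M) →
      ContinuousOn (fun t => E (y t)) (Ici 0) ∧ IntegrableOn (fun t => E (y t)) (Ioi 0) := by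
    intro y M hyc hy
    have hc : ContinuousOn (fun t => E (y t)) (Ici 0) :=
      hEc.comp hyc fun t ht => (hall _ (hy t ht).1.le).2
    refine ⟨hc, ?_⟩
    have hsq : IntegrableOn (fun t => ‖y t‖ ^ 2) (Ioi 0) :=
      integrableOn_of_intervalIntegral_le (by fun_prop) (fun _ _ => by positivity)
        fun t ht => (hy t ht).2
    refine Integrable.mono' (hsq.const_mul ε)
      ((hc.mono Ioi_subset_Ici_self).aestronglyMeasurable measurableSet_Ioi)
      (ae_restrict_of_forall_mem measurableSet_Ioi fun t ht => ?_)
    exact (hall _ (hy t (le_of_lt ht)).1.le).1.2.2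
  filter_upwards [hCS, hCV, hfin] with x hxS hxV hxfin
  refine ⟨hxfin, fun yS yT hS hT => ?_⟩
  have htS := hxV yS _ hS.1 hS.2 fun _ _ _ => rfl
  have htT := hxS yT _ hT.1 hT.2 fun _ _ _ => rfl
  have hcS : ContinuousOn yS (Ici 0) := fun t ht => (hS.2 t ht).continuousWithinAt
  have hcT : ContinuousOn yT (Ici 0) := fun t ht => (hT.2 t ht).continuousWithinAt
  obtain ⟨hEcS, hEiS⟩ := hEint yS _ hcS htS
  obtain ⟨hEcT, hEiT⟩ := hEint yT _ hcT htT
  refine ⟨hEiS, hEiT, ?_⟩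
  -- Here u* enters only through the vector field driving `yS`; it need not be an admissible
  -- control.
  have hlower : valueS P x - V x ≤ ∫ t in Ioi (0 : ℝ), |E (yS t)| := by
    refine le_of_forall_pos_le_add fun δ hδ => ?_
    -- Square integrability yields one time at which V_S is below δ; convergence of the trajectory
    -- to 0 is not needed.
    obtain ⟨T, hT0, hTδ⟩ := exists_lt_of_intervalIntegral_le (h := fun t => |Cv| * ‖yS t‖ ^ 2)
      (M := |Cv| * (CV * ‖x‖ ^ 2)) (by fun_prop) (fun T hT => by
        rw [intervalIntegral.integral_const_mul]
        gcongr
        exact (htS T hT).2) hδ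
    have h1 := sub_le_integral_of_hasDerivWithinAt_Ici hT0
      (g := fun t => V (yS t) - valueS P (yS t)) (φ := fun t => |E (yS t)|)
      (fun t ht =>
        ((hall _ (htS t ht.1).1.le).1.1.2.1.hasFDerivAt.comp_hasDerivWithinAt t (hS.2 t ht.1)).sub
        ((hall _ (htS t ht.1).1.le).1.1.1.1.hasFDerivAt.comp_hasDerivWithinAt t (hS.2 t ht.1)))
      hEcS.abs fun t ht => by
        have e1 := fderiv_closedLoop (f := f) (B := B) (Q := Q) hR V (yS t)
        have e2 := fderiv_controlled (f := f) (B := B) (Q := Q) hR (valueS P) (yS t)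
          (feedback B R V (yS t))
        have e3 := (hall _ (htS t ht.1).1.le).1.2.1
        have e4 := posSemidef_nonneg hR.posSemidef
          (feedback B R V (yS t) - feedback B R (valueS P) (yS t))
        rw [closedLoop, e1, e2]
        have e5 := neg_le_abs (E (yS t))
        linarith
    simp only [hS.1] at h1
    have h2 := intervalIntegral_le_integral_Ioi_abs hEiS hT0
    have h3 := (hall _ (htS T hT0).1.le).1.1
    have h4 : Cv * ‖yS T‖ ^ 2 ≤ |Cv| * ‖yS T‖ ^ 2 := by
      gcongr
      exact le_abs_self _
    linarith [h3.1.2.2, h3.2.2.1]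
  have hupper : V x - valueS P x ≤ ∫ t in Ioi (0 : ℝ), |E (yT t)| := by
    have hmem : ∀ t, 0 ≤ t → yT t ∈ Metric.closedBall (0 : Fin d → ℝ) ρ := fun t ht => by
      simpa using (htT t ht).1.le
    have hkO : ContinuousOn (feedback B R (valueS P)) (Metric.closedBall 0 ρ) :=
      (continuousOn_feedback hO hBc (contDiffOn_valueS hP)).mono
        fun z hz => (hall z (by simpa using hz)).2
    have hkc : ContinuousOn (fun t => feedback B R (valueS P) (yT t)) (Ici 0) :=
      hkO.comp hcT hmem
    obtain ⟨D, hD⟩ := (isCompact_closedBall (0 : Fin d → ℝ) ρ).exists_bound_of_continuousOn hkO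
    have hint0 : 0 ≤ ∫ t in Ioi (0 : ℝ), |E (yT t)| := integral_nonneg fun _ => abs_nonneg _
    have hVS0 : 0 ≤ valueS P x := by
      have := (htT 0 le_rfl).1.le
      rw [hT.1] at this
      exact (hall x this).1.1.1.2.1
    -- Along the trapped `yT` the feedback is continuous and bounded, so it is a competitor in the
    -- infimum.
    have hle : valueENN f B Q R x ≤
        ENNReal.ofReal (valueS P x + ∫ t in Ioi (0 : ℝ), |E (yT t)|) := by
      refine valueENN_le_ofReal hf.continuous hBc hQ hR hT.1 hT.2 hkc
        (fun t ht => hD _ (hmem t ht)) fun T hT0 => ?_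
      have hℓ : ContinuousOn (fun t => runningCost Q R (yT t) (feedback B R (valueS P) (yT t)))
          (Ici 0) := continuousOn_runningCost hcT hkc
      have h1 := sub_le_integral_of_hasDerivWithinAt_Ici hT0 (g := fun t => valueS P (yT t))
        (φ := fun t => -runningCost Q R (yT t) (feedback B R (valueS P) (yT t)) + |E (yT t)|)
        (fun t ht => (hall _ (htT t ht.1).1.le).1.1.1.1.hasFDerivAt.comp_hasDerivWithinAt t
          (hT.2 t ht.1)) (hℓ.fun_neg.add hEcT.abs) fun t ht => by
            rw [closedLoop, fderiv_closedLoop (Q := Q) hR]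
            linarith [le_abs_self (E (yT t))]
      rw [intervalIntegral.integral_add (intervalIntegrable_of_continuousOn_Ici hℓ.fun_neg hT0)
        (intervalIntegrable_of_continuousOn_Ici hEcT.abs hT0), intervalIntegral.integral_neg,
        hT.1] at h1
      have h2 := intervalIntegral_le_integral_Ioi_abs hEiT hT0
      have h3 := (hall _ (htT T hT0).1.le).1.1.1.2.1
      linarith
    have := ENNReal.toReal_le_of_le_ofReal (by positivity) hle
    change V x ≤ _ at this
    linarith
  rw [abs_le]
  constructor
  · linarith [le_max_right (∫ t in Ioi (0 : ℝ), |E (yS t)|) (∫ t in Ioi (0 : ℝ), |E (yT t)|)]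
  · exact hlower.trans (le_max_left _ _)

lemma ofReal_abs_le_supNormOn {E : (Fin d → ℝ) → ℝ} {Ω : Set (Fin d → ℝ)} {x : Fin d → ℝ}
    (hx : x ∈ Ω) : ENNReal.ofReal |E x| ≤ supNormOn E Ω :=
  le_iSup₂ (f := fun x (_ : x ∈ Ω) => ENNReal.ofReal |E x|) x hx

/-- A function of quadratic order at the origin is bounded by its supremum norm times the square of
the distance from the origin, up to a constant. -/
lemma exists_abs_le_supNormOn {E : (Fin d → ℝ) → ℝ} {Ω : Set (Fin d → ℝ)} (hΩ : Ω ∈ 𝓝 0)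
    (hE : ∀ᶠ z in 𝓝 (0 : Fin d → ℝ), |E z| ≤ 1 * ‖z‖ ^ 2) (hfin : supNormOn E Ω ≠ ∞) :
    ∃ c > 0, ∀ᶠ z in 𝓝 (0 : Fin d → ℝ), |E z| ≤ c * (supNormOn E Ω).toReal * ‖z‖ ^ 2 := by
  by_cases h0 : supNormOn E Ω = 0
  · refine ⟨1, one_pos, ?_⟩
    filter_upwards [hΩ] with z hz
    have h1 := (ofReal_abs_le_supNormOn (E := E) hz).trans_eq h0
    have h2 : |E z| ≤ 0 := ENNReal.ofReal_eq_zero.1 (le_zero_iff.1 h1)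
    simpa [h0] using h2
  · have hpos := ENNReal.toReal_pos h0 hfin
    -- The constant may depend on E: it is chosen so that its product with the supremum is 1.
    refine ⟨(supNormOn E Ω).toReal⁻¹, inv_pos.2 hpos, ?_⟩
    rwa [inv_mul_cancel₀ hpos.ne']

/-- The bound hbρ keeps the trajectory in the ball where E is quadratically bounded; squaring the
decay gives 1/(2λ), which is relaxed to 1/λ. -/
lemma integral_abs_le_of_exp_decay {E : (Fin d → ℝ) → ℝ} {y : ℝ → Fin d → ℝ} {D ρ K lam b : ℝ}
    (hD : 0 ≤ D) (hE : ∀ z, ‖z‖ ≤ ρ → |E z| ≤ D * ‖z‖ ^ 2) (hlam : 0 < lam) (hb : 0 ≤ b)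
    (hbρ : |K| * b ≤ ρ) (hy : ∀ t, 0 ≤ t → ‖y t‖ ≤ K * Real.exp (-lam * t) * b) :
    ∫ t in Ioi (0 : ℝ), |E (y t)| ≤ D * K ^ 2 * b ^ 2 / lam := by
  have hneg : -(2 * lam) < 0 := by linarith
  have hI := integrableOn_exp_mul_Ioi hneg 0
  have hpt : ∀ t ∈ Ioi (0 : ℝ), |E (y t)| ≤ D * K ^ 2 * b ^ 2 * Real.exp (-(2 * lam) * t) := by
    intro t ht
    have ht0 : (0 : ℝ) < t := ht
    have h1 : ‖y t‖ ≤ |K| * Real.exp (-lam * t) * b :=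
      (hy t ht0.le).trans (by gcongr; exact le_abs_self K)
    have h2 : Real.exp (-lam * t) ≤ 1 := Real.exp_le_one_iff.2 (by nlinarith)
    have h3 : ‖y t‖ ≤ ρ := by
      refine (h1.trans ?_).trans hbρ
      calc |K| * Real.exp (-lam * t) * b ≤ |K| * 1 * b := by gcongr
        _ = _ := by ring
    calc |E (y t)| ≤ D * ‖y t‖ ^ 2 := hE _ h3
      _ ≤ D * (|K| * Real.exp (-lam * t) * b) ^ 2 := by gcongr
      _ = D * |K| ^ 2 * b ^ 2 * Real.exp (-lam * t) ^ 2 := by ring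
      _ = _ := by
        rw [sq_abs, ← Real.exp_nat_mul]
        congr 2
        push_cast
        ring
  calc ∫ t in Ioi (0 : ℝ), |E (y t)|
      ≤ ∫ t in Ioi (0 : ℝ), D * K ^ 2 * b ^ 2 * Real.exp (-(2 * lam) * t) := by
        refine integral_mono_of_nonneg (ae_of_all _ fun _ => abs_nonneg _) (hI.const_mul _)
          (ae_restrict_of_forall_mem measurableSet_Ioi hpt)
    _ = D * K ^ 2 * b ^ 2 * (1 / (2 * lam)) := by
        rw [integral_const_mul, integral_exp_mul_Ioi hneg]
        simp
    _ ≤ D * K ^ 2 * b ^ 2 * (1 / lam) := by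
        gcongr
        linarith
    _ = _ := by ring

end Main

end SDRE

/-! ### The theorem: residual bound and its exponential form -/

theorem mainTheorem3 {d m : ℕ}
    -- the control system, the cost and the semilinear form
    (f : (Fin d → ℝ) → Fin d → ℝ) (B : (Fin d → ℝ) → Matrix (Fin d) (Fin m) ℝ)
    (Q : Matrix (Fin d) (Fin d) ℝ) (R : Matrix (Fin m) (Fin m) ℝ)
    (A P : (Fin d → ℝ) → Matrix (Fin d) (Fin d) ℝ)
    (hf : ContDiff ℝ 1 f) (hB : ∀ i j, ContDiff ℝ 1 (fun x => B x i j))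
    (hQ : Q.PosSemidef) (hR : R.PosDef)
    -- the neighbourhood of the origin on which the semilinear form is studied
    (O : Set (Fin d → ℝ)) (hO : IsOpen O) (h0 : (0 : Fin d → ℝ) ∈ O)
    (hA : ContinuousOn A O) (hfA : ∀ x ∈ O, f x = A x *ᵥ x)
    (hstab : ∀ x ∈ O, SDRE.Stabilizable (A x) (B x))
    (hdet : ∀ x ∈ O, SDRE.Detectable (A x) (CFC.sqrt Q))
    -- the solution of the state-dependent Riccati equation
    (hPpsd : ∀ x ∈ O, (P x).PosSemidef)
    (hPric : ∀ x ∈ O, SDRE.SolvesRiccati (A x) (B x) Q R (P x))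
    (hP : ∀ i j, ContDiffOn ℝ 1 (fun x => P x i j) O)
    -- the optimal feedback makes sense near the origin
    (hV : ∀ᶠ x in 𝓝 (0 : Fin d → ℝ), DifferentiableAt ℝ (SDRE.value f B Q R) x) :
    (∀ᶠ x in 𝓝 (0 : Fin d → ℝ),
      SDRE.valueENN f B Q R x ≠ ∞ ∧
      ∀ yStar yTilde : ℝ → Fin d → ℝ,
        SDRE.IsSolution (SDRE.closedLoop f B R (SDRE.value f B Q R)) x yStar →
        SDRE.IsSolution (SDRE.closedLoop f B R (SDRE.valueS P)) x yTilde →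
        IntegrableOn (fun t => SDRE.hjbResidual f B Q R (SDRE.valueS P) (yStar t)) (Ioi 0) ∧
        IntegrableOn (fun t => SDRE.hjbResidual f B Q R (SDRE.valueS P) (yTilde t)) (Ioi 0) ∧
        |SDRE.valueS P x - SDRE.value f B Q R x| ≤
          max (∫ t in Ioi (0 : ℝ), |SDRE.hjbResidual f B Q R (SDRE.valueS P) (yStar t)|)
            (∫ t in Ioi (0 : ℝ), |SDRE.hjbResidual f B Q R (SDRE.valueS P) (yTilde t)|)) ∧
    (∀ Ω ∈ 𝓝 (0 : Fin d → ℝ), Ω ⊆ O → ∀ lam : ℝ, 0 < lam →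
      SDRE.ExpStable (SDRE.closedLoop f B R (SDRE.value f B Q R)) lam →
      SDRE.ExpStable (SDRE.closedLoop f B R (SDRE.valueS P)) lam →
      ∃ C : ℝ, 0 < C ∧ ∀ᶠ x in 𝓝 (0 : Fin d → ℝ),
        ENNReal.ofReal |SDRE.valueS P x - SDRE.value f B Q R x| ≤
          ENNReal.ofReal (C / lam) *
            SDRE.supNormOn (SDRE.hjbResidual f B Q R (SDRE.valueS P)) Ω) := by
  have hbound := SDRE.eventually_error_bound hf hB hQ hR hO h0 hA hfA (hdet 0 h0) hPpsd hPric hP hV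
  refine ⟨hbound, fun Ω hΩ _ lam hlam ⟨K₁, hK₁⟩ ⟨K₂, hK₂⟩ => ?_⟩
  set E := SDRE.hjbResidual f B Q R (SDRE.valueS P) with hE
  by_cases hfin : SDRE.supNormOn E Ω = ∞
  · refine ⟨1, one_pos, Eventually.of_forall fun x => ?_⟩
    rw [hfin, ENNReal.mul_top (by simpa using hlam)]
    exact le_top
  have hO' : O ∈ 𝓝 (0 : Fin d → ℝ) := hO.mem_nhds h0
  have hBc : Continuous B := continuous_pi fun i => continuous_pi fun j => (hB i j).continuous
  have hE2 := SDRE.hjbResidual_valueS_le hO' hR (hA.continuousAt hO') hBc.continuousAt hfA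
    (fun x hx => SDRE.transpose_eq_of_isHermitian (hPpsd x hx).isHermitian) hPric
    (fun i j => (hP i j).contDiffAt hO') one_pos
  obtain ⟨c, hc, hcE⟩ := SDRE.exists_abs_le_supNormOn hΩ hE2 hfin
  obtain ⟨ρ, hρ, hρE⟩ := SDRE.eventually_nhds_zero_iff.1 hcE
  set s := (SDRE.supNormOn E Ω).toReal with hs
  have hs0 : 0 ≤ s := ENNReal.toReal_nonneg
  -- One constant dominating both squared stability constants; the 1 ensures C > 0.
  set K := K₁ ^ 2 + K₂ ^ 2 + 1 with hK
  have hK0 : 0 < K := by positivity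
  have hnear : ∀ b : ℝ, 0 < b → ∀ k : ℝ, ∀ᶠ x in 𝓝 (0 : Fin d → ℝ), k * ‖x‖ < b := fun b hb k =>
    (by fun_prop : ContinuousAt (fun x : Fin d → ℝ => k * ‖x‖) 0).eventually_lt_const
      (by simpa using hb)
  refine ⟨c * K, by positivity, ?_⟩
  filter_upwards [hbound, hK₁, hK₂, hnear ρ hρ |K₁|, hnear ρ hρ |K₂|, hnear 1 one_pos 1]
    with x hx h1 h2 hx1 hx2 hx3
  obtain ⟨⟨y₁, hy₁⟩, hd₁⟩ := h1
  obtain ⟨⟨y₂, hy₂⟩, hd₂⟩ := h2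
  obtain ⟨-, -, hle⟩ := hx.2 y₁ y₂ hy₁ hy₂
  have hcs : 0 ≤ c * s := by positivity
  have hxsq : ‖x‖ ^ 2 ≤ 1 := by nlinarith [norm_nonneg x]
  have hmono : ∀ k : ℝ, k ^ 2 ≤ K → c * s * k ^ 2 * ‖x‖ ^ 2 / lam ≤ c * K / lam * s := by
    intro k hk
    calc c * s * k ^ 2 * ‖x‖ ^ 2 / lam ≤ c * s * K * 1 / lam := by gcongr
      _ = _ := by ring
  have i1 := (SDRE.integral_abs_le_of_exp_decay hcs hρE hlam (norm_nonneg x) hx1.le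
    (hd₁ y₁ hy₁)).trans (hmono K₁ (by rw [hK]; nlinarith [sq_nonneg K₂]))
  have i2 := (SDRE.integral_abs_le_of_exp_decay hcs hρE hlam (norm_nonneg x) hx2.le
    (hd₂ y₂ hy₂)).trans (hmono K₂ (by rw [hK]; nlinarith [sq_nonneg K₁]))
  rw [← ENNReal.ofReal_toReal hfin, ← ENNReal.ofReal_mul (by positivity)]
  exact ENNReal.ofReal_le_ofReal (hle.trans (max_le i1 i2))
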